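/- Let $n\ge 2$ and let $l_1,\dots,l_n>0$ satisfy $l_1>l_i$ for all $i=2,\dots,n$. Let $M$ be the moduli space of the planar robot arm with consecutive link lengths $l_1,\dots,l_n$, that is, the space of all tuples $R=(r_0,\dots,r_n)$ of points of the Euclidean plane $\mathbb{R}^2$ with $r_0=(0,0)$, $r_1=(l_1,0)$ and $|r_{i-1}r_i|=l_i$ for $i=1,\dots,n$, with the topology induced from $(\mathbb{R}^2)^{n+1}$ and the smooth structure of an $(n-1)$-dimensional torus given by the angles $\beta_1,\dots,\beta_{n-1}$ from $\overrightarrow{r_0r_1}$ to $\overrightarrow{r_kr_{k+1}}$. For $R\in M$ with $r_i=(x_i,y_i)$ let $A(R)$ be the oriented area, $2A(R)=\sum_{i=0}^{n-1}(x_iy_{i+1}-x_{i+1}y_i)+(x_ny_0-x_0y_n)$. Call $R\in M$ quasicyclic if all its vertices lie on a circle or on a straight line, and aligned if all its vertices lie on a straight line. Then: (1) The set of all quasicyclic configurations in $M$ is the union of $2^{n-2}$ pairwise disjoint topologically embedded circles. (2) Each of these circles contains at least two critical points of the function $A$ on $M$. (3) If all critical points of $A$ on $M$ are nondegenerate, then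 $A$ is a perfect Morse function on $M$ (that is, all its critical points are nondegenerate and their number equals the sum of the Betti numbers of $M$) if and only if each of these circles contains exactly two critical points of $A$. (4) Each of these circles contains exactly two aligned configurations. -/

import Mathlib

namespace RobotArm

/-- The Euclidean plane. -/
abbrev Plane : Type := EuclideanSpace ℝ (Fin 2)

/-- The moduli space of the planar robot arm with `m + 1` links, whose consecutive lengths are
`l 0, …, l m`: the tuples of vertices `R 0, …, R (m + 1)` with prescribed distances between
consecutive vertices, the first two vertices being fixed at `(0, 0)` and `(l 0, 0)`.
It carries the topology of a subspace of a Euclidean space. -/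
def moduliSpace {m : ℕ} (l : Fin (m + 1) → ℝ) : Set (Fin (m + 2) → Plane) :=
  {R | R 0 = !₂[(0 : ℝ), 0] ∧ R 1 = !₂[l 0, 0] ∧
    ∀ i : Fin (m + 1), dist (R i.castSucc) (R i.succ) = l i}

/-- All vertices lie on a circle. -/
def IsCyclic {k : ℕ} (R : Fin k → Plane) : Prop :=
  ∃ (c : Plane) (ρ : ℝ), 0 < ρ ∧ ∀ i, dist (R i) c = ρ

/-- All vertices lie on a straight line. -/
def IsAligned {k : ℕ} (R : Fin k → Plane) : Prop :=
  Collinear ℝ (Set.range R)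

/-- All vertices lie on a circle or on a straight line. -/
def IsQuasicyclic {k : ℕ} (R : Fin k → Plane) : Prop :=
  IsCyclic R ∨ IsAligned R

/-- The cross product `x y' - x' y` of two vectors of the plane. -/
def cross (p q : Plane) : ℝ := p 0 * q 1 - q 0 * p 1

/-- The oriented area of the polygon obtained from the arm by adding the side that joins the
last vertex to the first one. -/
noncomputable def area {m : ℕ} (R : Fin (m + 2) → Plane) : ℝ :=
  ((∑ i : Fin (m + 1), cross (R i.castSucc) (R i.succ)) + cross (R (Fin.last (m + 1))) (R 0)) / 2

/-- The angle coordinates on the moduli space: `β j` is the direction of link number `j + 1`,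
relative to link number `0`, whose direction is `0`. -/
noncomputable def armOfAngles {m : ℕ} (l : Fin (m + 1) → ℝ) (β : Fin m → ℝ) :
    Fin (m + 2) → Plane := fun k =>
  ∑ i : Fin (m + 1) with i.castSucc < k,
    l i • !₂[Real.cos (Fin.cons (α := fun _ => ℝ) 0 β i),
      Real.sin (Fin.cons (α := fun _ => ℝ) 0 β i)]

/-- The oriented area in the angle coordinates. -/
noncomputable def areaOfAngles {m : ℕ} (l : Fin (m + 1) → ℝ) (β : Fin m → ℝ) : ℝ :=
  area (armOfAngles l β)

/-- `R` is a critical point of the oriented area on the moduli space: the differential of the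
oriented area, computed in the angle coordinates, vanishes at `R`. -/
def IsCriticalPoint {m : ℕ} (l : Fin (m + 1) → ℝ) (R : moduliSpace l) : Prop :=
  ∃ β : Fin m → ℝ, armOfAngles l β = R ∧
    HasFDerivAt (areaOfAngles l) (0 : (Fin m → ℝ) →L[ℝ] ℝ) β

/-- `R` is a nondegenerate critical point of the oriented area on the moduli space: it is
critical and the Hessian at `R`, computed in the angle coordinates, has trivial kernel. -/
def IsNondegenerateCriticalPoint {m : ℕ} (l : Fin (m + 1) → ℝ) (R : moduliSpace l) : Prop :=
  ∃ β : Fin m → ℝ, armOfAngles l β = R ∧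
    HasFDerivAt (areaOfAngles l) (0 : (Fin m → ℝ) →L[ℝ] ℝ) β ∧
    ∀ v : Fin m → ℝ, (∀ w : Fin m → ℝ, fderiv ℝ (fderiv ℝ (areaOfAngles l)) β v w = 0) → v = 0

/-- The `k`-th Betti number of a topological space: the dimension of its `k`-th singular homology
with rational coefficients. -/
noncomputable def bettiNumber (X : Type) [TopologicalSpace X] (k : ℕ) : ℕ∞ :=
  Cardinal.toENat (Module.rank ℚ
    (((AlgebraicTopology.singularHomologyFunctor (ModuleCat.{0} ℚ) k).obj
      (ModuleCat.of ℚ ℚ)).obj (TopCat.of X)))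

/-- The oriented area is a perfect Morse function on the moduli space: all its critical points are
nondegenerate, and their number is the sum of the Betti numbers of the moduli space. -/
def AreaIsPerfectMorse {m : ℕ} (l : Fin (m + 1) → ℝ) : Prop :=
  (∀ R : moduliSpace l, IsCriticalPoint l R → IsNondegenerateCriticalPoint l R) ∧
    {R : moduliSpace l | IsCriticalPoint l R}.encard = ∑' k : ℕ, bettiNumber (moduliSpace l) k

/-- A subset of a topological space that is an embedded topological circle. -/
def IsEmbeddedCircle {X : Type} [TopologicalSpace X] (C : Set X) : Prop :=
  ∃ γ : Circle → X, Topology.IsEmbedding γ ∧ Set.range γ = C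

end RobotArm

/-! ### Chains under a free action of the integers -/

section
open CategoryTheory Limits AlgebraicTopology Simplicial

/-! Identify the plane with ℂ. A circle through the first two vertices 0 and `l 0`, or the real line
as its degenerate case, is encoded by its unit tangent direction u at `l 0`; u and -u give the same
curve with opposite orientations. Its diameter is at least `l 0`, so it exceeds every other link.
Hence from each point of the curve exactly two chords of length `l i` leave, one forwards and one
backwards. An inscribed arm is thus a pair (u, ε), with ε the signs of the links after the first,
modulo (u, ε) ~ (-u, -ε). Normalising the sign of the second link to +1 leaves 2^m sign vectors,
each sweeping out a circle of arms (`inscribedArm`, `exists_eq_inscribedArm`). These circles are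
embedded and disjoint because u can be read off the second link (`exists_pos_mul_eq`), and then the
signs as well (`inscribedArm_inj`). The aligned arms are those with u = ±1.

The partial derivatives of the area telescope, so an arm is critical exactly when it is inscribed in
the circle with the segment from first to last vertex as diameter (`isCriticalPoint_iff_diacyclic`).
On each circle this happens wherever the product W of the half turns has zero real part. Along the
circle Re W takes the values 1, -1, 1 at the angles 0, π, 2π, whence two critical points.

The moduli space is a torus of dimension m + 1, with Betti sum 2^(m+1), twice the number of circles.
All critical points lie on the circles, at least two on each, so the total is 2^(m+1) exactly when
each circle carries two (`ENat.sum_eq_iff`). The Betti numbers of tori come from the covering X × ℝ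
→ X × S¹: its deck transformation is homotopic to the identity, so the long exact sequence splits
into short ones and yields Pascal's rule. -/

lemma Int.exists_sub_succ_eq {A : Type*} [AddCommGroup A] (a : ℤ → A) :
    ∃ r : ℤ → A, r 0 = 0 ∧ ∀ k, r k - r (k + 1) = a k := by
  -- For each k at most one of the two intervals is nonempty, so this is a signed sum from k to 0.
  refine ⟨fun k => ∑ i ∈ Finset.Ico k 0, a i - ∑ i ∈ Finset.Ico 0 k, a i, by simp, fun k => ?_⟩
  rcases lt_or_ge k 0 with hk | hk
  · have h1 : Finset.Ico 0 k = ∅ := Finset.Ico_eq_empty (by omega)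
    have h2 : Finset.Ico 0 (k + 1) = ∅ := Finset.Ico_eq_empty (by omega)
    have h3 : Finset.Ico k 0 = insert k (Finset.Ico (k + 1) 0) := by ext; simp; omega
    simp [h1, h2, h3]
  · have h1 : Finset.Ico k 0 = ∅ := Finset.Ico_eq_empty (by omega)
    have h2 : Finset.Ico (k + 1) 0 = ∅ := Finset.Ico_eq_empty (by omega)
    have h3 : Finset.Ico 0 (k + 1) = insert k (Finset.Ico 0 k) := by ext; simp; omega
    simp [h1, h2, h3]

/-- If `p : S → Q` is the quotient by a free action of `ℤ` with generator `τ`, then the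
formal sums over `S` admit a primitive for `1 - τ`, normalised to vanish on a section. -/
lemma exists_primitive_of_free_action {S Q A : Type*} [AddCommGroup A] (τ : Equiv.Perm S)
    (p : S → Q) (h : S → ℤ) (hp : Function.Surjective p) (hτp : ∀ x, p (τ x) = p x)
    (hτ : ∀ x, h (τ x) = h x + 1) (hinj : ∀ x y, p x = p y → h x = h y → x = y) (a : S → A) :
    ∃ (s : Q → S) (r : S → A), (∀ q, p (s q) = q) ∧ (∀ q, r (s q) = 0) ∧
      (∀ x, r x - r (τ x) = a x) ∧
      ∀ P : S → Prop, (∀ q, P (s q)) → (∀ x, P x ↔ P (τ x)) → ∀ x, P x := by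
  have hzpow (k : ℤ) : ∀ x, p ((τ ^ k) x) = p x ∧ h ((τ ^ k) x) = h x + k := by
    induction k with
    | zero => simp
    | succ k ih =>
      intro x
      rw [zpow_add_one, Equiv.Perm.mul_apply, (ih _).1, (ih _).2, hτp, hτ]
      exact ⟨rfl, by ring⟩
    | pred k ih =>
      intro x
      have h1 := hτp (τ⁻¹ x)
      have h2 := hτ (τ⁻¹ x)
      rw [Equiv.Perm.inv_def, Equiv.apply_symm_apply, ← Equiv.Perm.inv_def] at h1 h2
      rw [zpow_sub_one, Equiv.Perm.mul_apply, (ih _).1, (ih _).2, ← h1]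
      exact ⟨rfl, by omega⟩
  choose s₀ hs₀ using hp
  let s : Q → S := fun q => (τ ^ (-h (s₀ q))) (s₀ q)
  have hs (q) : p (s q) = q := by rw [(hzpow _ _).1, hs₀]
  have hs' (q) : h (s q) = 0 := by rw [(hzpow _ _).2]; ring
  have hx (x) : x = (τ ^ (h x)) (s (p x)) := by
    apply hinj
    · rw [(hzpow _ _).1, hs]
    · rw [(hzpow _ _).2, hs']; ring
  -- On each orbit, identified with ℤ by the height `h`, the equation becomes a difference equation.
  choose r hr0 hr using fun q => Int.exists_sub_succ_eq fun k => a ((τ ^ k) (s q))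
  refine ⟨s, fun x => r (p x) (h x), hs, fun q => ?_, fun x => ?_, fun P hP hPτ x => ?_⟩
  · simp [hs, hs', hr0]
  · simp only [hτp, hτ, hr, ← hx]
  · have key (k : ℤ) : ∀ y, P y ↔ P ((τ ^ k) y) := by
      induction k with
      | zero => simp
      | succ k ih =>
        intro y
        rw [zpow_add_one, Equiv.Perm.mul_apply, ← ih, ← hPτ]
      | pred k ih =>
        intro y
        rw [zpow_sub_one, Equiv.Perm.mul_apply, ← ih, hPτ (τ⁻¹ y), Equiv.Perm.inv_def, Equiv.apply_symm_apply]
    rw [hx x, ← key]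
    exact hP _

namespace SSet
variable {C : Type*} [Category* C] [Abelian C] [HasCoproducts.{0} C] (R : C)
  {X Y : SSet.{0}} (τ : X ⟶ X) (p : X ⟶ Y) (w : τ ≫ p = p)

/-- The sequence `C(X) → C(X) → C(Y)` formed by `1 - τ` and `p`. -/
noncomputable def quotientSequence : ShortComplex (ChainComplex C ℕ) :=
  ShortComplex.mk (𝟙 (X.chainComplex R) - SSet.chainComplexMap τ R) (SSet.chainComplexMap p R) (by
    rw [Preadditive.sub_comp, Category.id_comp, ← Functor.map_comp, w, sub_self])

/-- The sequence splits in each degree. The section σ lifts each simplex of the quotient to one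
chosen in its orbit, and the retraction ρ is a primitive for 1 - τ vanishing on the chosen
simplices. The height `h` rules out finite orbits, on which such a primitive need not exist. -/
lemma quotientSequence_shortExact
    (hτ : ∀ n, Function.Bijective (τ.app (.op ⦋n⦌)))
    (hp : ∀ n, Function.Surjective (p.app (.op ⦋n⦌)))
    (hh : ∀ n, ∃ h : X _⦋n⦌ → ℤ, (∀ x, h (τ.app _ x) = h x + 1) ∧
      ∀ x y, p.app _ x = p.app _ y → h x = h y → x = y) :
    (quotientSequence R τ p w).ShortExact := by
  refine HomologicalComplex.shortExact_of_degreewise_shortExact _ fun n => ?_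
  obtain ⟨h, h1, h2⟩ := hh n
  obtain ⟨s, r, hs, hr, hrτ, hind⟩ := exists_primitive_of_free_action
    (Equiv.ofBijective _ (hτ n)) (p.app (.op ⦋n⦌)) h (hp n)
    (fun x => congr_arg (fun f : X ⟶ Y => f.app (.op ⦋n⦌) x) w) h1 h2
    (fun x => X.ιChainComplex (R := R) x)
  simp only [Equiv.ofBijective_apply] at hrτ hind
  let ρ : (X.chainComplex R).X n ⟶ (X.chainComplex R).X n :=
    (X.isColimitChainComplexXCofan R n).desc (Cofan.mk _ r)
  let σ : (Y.chainComplex R).X n ⟶ (X.chainComplex R).X n :=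
    (Y.isColimitChainComplexXCofan R n).desc (Cofan.mk _ fun q => X.ιChainComplex (s q))
  have hρ (x) : X.ιChainComplex x ≫ ρ = r x :=
    (X.isColimitChainComplexXCofan R n).fac (Cofan.mk _ r) ⟨x⟩
  have hσ (q) : Y.ιChainComplex q ≫ σ = X.ιChainComplex (s q) :=
    (Y.isColimitChainComplexXCofan R n).fac (Cofan.mk _ fun q => X.ιChainComplex (s q)) ⟨q⟩
  let F : (X.chainComplex R).X n ⟶ (X.chainComplex R).X n := 𝟙 _ - (chainComplexMap τ R).f n
  let G : (X.chainComplex R).X n ⟶ (Y.chainComplex R).X n := (chainComplexMap p R).f n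
  have hf (x) : X.ιChainComplex x ≫ F = X.ιChainComplex x - X.ιChainComplex (τ.app _ x) := by
    rw [Preadditive.comp_sub, ι_chainComplexMap_f, Category.comp_id]
  have hg (x) : X.ιChainComplex x ≫ G = Y.ιChainComplex (p.app _ x) :=
    ι_chainComplexMap_f _ _ _ _ _
  have hpτ (x) : p.app (.op ⦋n⦌) (τ.app _ x) = p.app _ x :=
    congr_arg (fun f : X ⟶ Y => f.app (.op ⦋n⦌) x) w
  have hFG : F ≫ G = 0 := congr_arg (fun f => f.f n) (quotientSequence R τ p w).zero
  -- The identity holds on the chosen simplices, where `r` vanishes, and it passes along orbits in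
  -- both directions.
  have hind' (x) : r x ≫ F + X.ιChainComplex (s (p.app _ x)) = X.ιChainComplex x := by
    refine hind (fun x => r x ≫ F + X.ιChainComplex (s (p.app _ x)) = X.ιChainComplex x)
      (fun q => ?_) (fun x => ?_) x
    · simp only [hr, hs]
      rw [Limits.zero_comp, zero_add]
    · simp only [hpτ]
      have h3 := hrτ x
      rw [sub_eq_iff_eq_add] at h3
      rw [h3, Preadditive.add_comp, hf, ← sub_eq_zero,
        ← sub_eq_zero (b := X.ιChainComplex (τ.app _ x))]
      abel_nf
  change (ShortComplex.mk F G hFG).ShortExact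
  refine ShortComplex.Splitting.shortExact (ShortComplex.Splitting.mk ρ σ ?_ ?_ ?_)
  · refine X.chainComplex_hom_ext fun x => ?_
    change X.ιChainComplex x ≫ F ≫ ρ = X.ιChainComplex x ≫ 𝟙 _
    rw [reassoc_of% hf, Preadditive.sub_comp, hρ, hρ, hrτ, Category.comp_id]
  · refine Y.chainComplex_hom_ext fun q => ?_
    change Y.ιChainComplex q ≫ σ ≫ G = Y.ιChainComplex q ≫ 𝟙 _
    rw [reassoc_of% hσ, hg, hs, Category.comp_id]
  · refine X.chainComplex_hom_ext fun x => ?_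
    change X.ιChainComplex x ≫ (ρ ≫ F + G ≫ σ) = X.ιChainComplex x ≫ 𝟙 _
    rw [Preadditive.comp_add, reassoc_of% hρ, reassoc_of% hg, hσ, Category.comp_id, hind']

end SSet

/-! ### The infinite cyclic covering of a product with the circle -/

open CategoryTheory Limits AlgebraicTopology Simplicial

namespace RobotArm
open Real

instance (n : ℕ) : ContractibleSpace (stdSimplex ℝ (Fin (n + 1))) :=
  (convex_stdSimplex ℝ _).contractibleSpace ⟨_, single_mem_stdSimplex ℝ 0⟩

instance (n : ℕ) : LocallyPathConnectedSpace (stdSimplex ℝ (Fin (n + 1))) :=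
  (convex_stdSimplex ℝ _).locallyPathConnectedSpace

variable (X : Type) [TopologicalSpace X]

/-- The deck transformation of the covering `X × ℝ → X × Circle`. -/
noncomputable def deckMap : C(X × ℝ, X × ℝ) :=
  ⟨fun q => (q.1, q.2 + 2 * π), by fun_prop⟩

/-- The covering `X × ℝ → X × Circle`. -/
noncomputable def coveringMap : C(X × ℝ, X × Circle) :=
  ⟨fun q => (q.1, Circle.exp q.2), by fun_prop⟩

lemma toSSet_map_toSSetObjEquiv {Y Z : TopCat.{0}} (f : Y ⟶ Z) (n : ℕ)
    (x : (TopCat.toSSet.obj Y) _⦋n⦌) :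
    Z.toSSetObjEquiv _ ((TopCat.toSSet.map f).app _ x) = f.hom.comp (Y.toSSetObjEquiv _ x) := rfl

lemma coveringMap_comp_deckMap : (coveringMap X).comp (deckMap X) = coveringMap X := by
  ext q
  · rfl
  · simp [coveringMap, deckMap, Circle.exp_add]

lemma exists_lift_circle (n : ℕ) (f : C(stdSimplex ℝ (Fin (n + 1)), Circle)) :
    ∃ g : C(stdSimplex ℝ (Fin (n + 1)), ℝ), ∀ x, Circle.exp (g x) = f x := by
  have := SimplyConnectedSpace.ofContractible (stdSimplex ℝ (Fin (n + 1)))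
  obtain ⟨x₀⟩ := (inferInstance : Nonempty (stdSimplex ℝ (Fin (n + 1))))
  obtain ⟨t, ht⟩ := Circle.isAddQuotientCoveringMap_exp.surjective (f x₀)
  obtain ⟨g, hg, -⟩ := Circle.isCoveringMap_exp.existsUnique_continuousMap_lifts f x₀ t ht
  exact ⟨g, congr_fun hg.2⟩

lemma eq_add_of_exp_eq {A : Type*} [TopologicalSpace A] [PreconnectedSpace A] (g₁ g₂ : C(A, ℝ))
    (h : ∀ x, Circle.exp (g₁ x) = Circle.exp (g₂ x)) (x₀ : A)
    (h₀ : ⌊g₁ x₀ / (2 * π)⌋ = ⌊g₂ x₀ / (2 * π)⌋) : g₁ = g₂ := by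
  have key : g₁ x₀ = g₂ x₀ := by
    obtain ⟨m, hm⟩ := Circle.exp_eq_exp.1 (h x₀)
    have h2 : g₁ x₀ / (2 * π) = g₂ x₀ / (2 * π) + m := by
      rw [hm]; field_simp
    rw [h2, Int.floor_add_intCast] at h₀
    have : m = 0 := by omega
    simp [hm, this]
  exact DFunLike.coe_injective <| Circle.isCoveringMap_exp.eq_of_comp_eq g₁.continuous
    g₂.continuous (funext h) x₀ key

variable {C : Type*} [Category* C] [Abelian C] [HasCoproducts.{0} C] (R : C)

/-- The sequence of chain complexes attached to the covering `X × ℝ → X × Circle`. -/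
noncomputable abbrev coveringSequence : ShortComplex (ChainComplex C ℕ) :=
  SSet.quotientSequence R (TopCat.toSSet.map (TopCat.ofHom (deckMap X)))
    (TopCat.toSSet.map (TopCat.ofHom (coveringMap X))) (by
      rw [← Functor.map_comp, ← TopCat.ofHom_comp, coveringMap_comp_deckMap])

lemma coveringSequence_shortExact : (coveringSequence X R).ShortExact := by
  apply SSet.quotientSequence_shortExact
  · intro n
    have h : Function.Bijective fun f : C(stdSimplex ℝ (Fin (n + 1)), X × ℝ) =>
        (deckMap X).comp f := by
      refine Function.bijective_iff_has_inverse.2 ⟨fun f => (⟨fun q => (q.1, q.2 - 2 * π),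
        by fun_prop⟩ : C(X × ℝ, X × ℝ)).comp f, fun f => ?_, fun f => ?_⟩ <;>
      · ext x <;> simp [deckMap]
    have := ((TopCat.of (X × ℝ)).toSSetObjEquiv (.op ⦋n⦌)).symm.bijective.comp (h.comp
      ((TopCat.of (X × ℝ)).toSSetObjEquiv (.op ⦋n⦌)).bijective)
    exact this
  · intro n y
    obtain ⟨g, hg⟩ := exists_lift_circle n (ContinuousMap.snd.comp
      ((TopCat.of (X × Circle)).toSSetObjEquiv (.op ⦋n⦌) y))
    refine ⟨((TopCat.of (X × ℝ)).toSSetObjEquiv (.op ⦋n⦌)).symm ((ContinuousMap.fst.comp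
      ((TopCat.of (X × Circle)).toSSetObjEquiv (.op ⦋n⦌) y)).prodMk g), ?_⟩
    apply ((TopCat.of (X × Circle)).toSSetObjEquiv (.op ⦋n⦌)).injective
    rw [toSSet_map_toSSetObjEquiv, Equiv.apply_symm_apply]
    refine ContinuousMap.ext fun x => Prod.ext rfl ?_
    exact hg x
  · intro n
    obtain ⟨x₀⟩ := (inferInstance : Nonempty (stdSimplex ℝ (Fin (n + 1))))
    -- The height of a simplex is the index of the fundamental domain containing the image of a base
    -- point.
    refine ⟨fun f => ⌊((TopCat.of (X × ℝ)).toSSetObjEquiv (.op ⦋n⦌) f x₀).2 / (2 * π)⌋,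
      fun f => ?_, fun f g h₁ h₂ => ?_⟩
    · change ⌊(((TopCat.of (X × ℝ)).toSSetObjEquiv (.op ⦋n⦌) f x₀).2 + 2 * π) / (2 * π)⌋ = _
      rw [add_div, div_self (by positivity), Int.floor_add_one]
    · apply ((TopCat.of (X × ℝ)).toSSetObjEquiv (.op ⦋n⦌)).injective
      replace h₁ := congr_arg ((TopCat.of (X × Circle)).toSSetObjEquiv (.op ⦋n⦌)) h₁
      rw [toSSet_map_toSSetObjEquiv, toSSet_map_toSSetObjEquiv] at h₁
      have h₃ := eq_add_of_exp_eq
        (ContinuousMap.snd.comp ((TopCat.of (X × ℝ)).toSSetObjEquiv (.op ⦋n⦌) f))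
        (ContinuousMap.snd.comp ((TopCat.of (X × ℝ)).toSSetObjEquiv (.op ⦋n⦌) g))
        (fun x => congr_arg Prod.snd (DFunLike.congr_fun h₁ x)) x₀ h₂
      refine ContinuousMap.ext fun x => Prod.ext ?_ (DFunLike.congr_fun h₃ x)
      have h₄ := congr_arg Prod.fst (DFunLike.congr_fun h₁ x)
      exact h₄

/-- The deck transformation is homotopic to the identity. -/
noncomputable def deckHomotopy : (ContinuousMap.id (X × ℝ)).Homotopy (deckMap X) where
  toFun q := (q.2.1, q.2.2 + q.1 * (2 * π))
  continuous_toFun := by fun_prop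
  map_zero_left q := by simp
  map_one_left q := by simp [deckMap]

/-- Homotopy invariance makes the deck transformation act as the identity on homology, so 1 - τ acts
as zero. -/
lemma homologyMap_coveringSequence_f (n : ℕ) :
    HomologicalComplex.homologyMap (coveringSequence X R).f n = 0 := by
  have h := TopCat.Homotopy.congr_homologyMap_singularChainComplexFunctor
    (f := 𝟙 (TopCat.of (X × ℝ))) (g := TopCat.ofHom (deckMap X)) (deckHomotopy X) R n
  rw [CategoryTheory.Functor.map_id] at h
  exact (HomologicalComplex.homologyMap_sub _ _ n).trans (sub_eq_zero.2 h)

end RobotArm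

/-! ### Betti numbers of tori -/

open CategoryTheory Limits AlgebraicTopology Simplicial

/-- Dimensions in an exact sequence `0 → A → B → C → 0` of vector spaces. -/
lemma ModuleCat.rank_eq_add_of_exact {K : Type} [Field K] {A B C : ModuleCat.{0} K} (f : A ⟶ B)
    (g : B ⟶ C) (w : f ≫ g = 0) (h : (ShortComplex.mk f g w).Exact) (hf : Mono f) (hg : Epi g) :
    Module.rank K B = Module.rank K A + Module.rank K C :=
  ModuleCat.free_shortExact_rank_add (S := ShortComplex.mk f g w)
    { exact := h, mono_f := hf, epi_g := hg }

namespace RobotArm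
open Real

lemma rank_eq_of_iso {A B : ModuleCat.{0} ℚ} (e : A ≅ B) : Module.rank ℚ A = Module.rank ℚ B :=
  e.toLinearEquiv.rank_eq

lemma bettiNumber_congr {X Y : Type} [TopologicalSpace X] [TopologicalSpace Y] (e : X ≃ₜ Y)
    (k : ℕ) : bettiNumber X k = bettiNumber Y k := by
  unfold bettiNumber
  rw [rank_eq_of_iso (((singularHomologyFunctor (ModuleCat.{0} ℚ) k).obj
      (ModuleCat.of ℚ ℚ)).mapIso (TopCat.isoOfHomeo (X := TopCat.of X) (Y := TopCat.of Y) e))]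

section
variable (X : Type) [TopologicalSpace X]

/-- The contraction of the factor `ℝ` of `X × ℝ`. -/
noncomputable def contractionHomotopy : (ContinuousMap.id (X × ℝ)).Homotopy
    ⟨fun q => (q.1, 0), by fun_prop⟩ where
  toFun q := (q.2.1, (1 - q.1) * q.2.2)
  continuous_toFun := by fun_prop
  map_zero_left q := by simp
  map_one_left q := by simp

/-- Homotopy invariance of singular homology for the projection `X × ℝ → X`. -/
noncomputable def homologyProdRealIso (k : ℕ) :
    ((singularHomologyFunctor (ModuleCat.{0} ℚ) k).obj (ModuleCat.of ℚ ℚ)).obj (TopCat.of (X × ℝ)) ≅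
    ((singularHomologyFunctor (ModuleCat.{0} ℚ) k).obj (ModuleCat.of ℚ ℚ)).obj (TopCat.of X) where
  hom := ((singularHomologyFunctor (ModuleCat.{0} ℚ) k).obj (ModuleCat.of ℚ ℚ)).map
    (TopCat.ofHom ⟨Prod.fst, continuous_fst⟩)
  inv := ((singularHomologyFunctor (ModuleCat.{0} ℚ) k).obj (ModuleCat.of ℚ ℚ)).map
    (TopCat.ofHom ⟨fun x => (x, 0), by fun_prop⟩)
  hom_inv_id := by
    rw [← Functor.map_comp, ← CategoryTheory.Functor.map_id]
    exact (TopCat.Homotopy.congr_homologyMap_singularChainComplexFunctor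
      (f := 𝟙 (TopCat.of (X × ℝ))) (g := TopCat.ofHom ⟨fun q => (q.1, 0), by fun_prop⟩)
      (contractionHomotopy X) _ k).symm
  inv_hom_id := by
    rw [← Functor.map_comp, ← CategoryTheory.Functor.map_id]
    rfl

lemma bettiNumber_prod_real (k : ℕ) : bettiNumber (X × ℝ) k = bettiNumber X k := by
  unfold bettiNumber
  rw [rank_eq_of_iso (homologyProdRealIso X k)]

/-- In degree 0 the covering induces a map that is injective because 1 - τ acts as zero, and
surjective because the long exact sequence ends there. -/
lemma bettiNumber_prod_circle_zero : bettiNumber (X × Circle) 0 = bettiNumber X 0 := by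
  rw [← bettiNumber_prod_real X]
  have hS := coveringSequence_shortExact X (ModuleCat.of ℚ ℚ)
  have hf := homologyMap_coveringSequence_f X (ModuleCat.of ℚ ℚ) 0
  have h := hS.homology_exact₂ 0
  have : Mono (HomologicalComplex.homologyMap (coveringSequence X (ModuleCat.of ℚ ℚ)).g 0) :=
    h.mono_g hf
  have : Epi (HomologicalComplex.homologyMap (coveringSequence X (ModuleCat.of ℚ ℚ)).g 0) := by
    have := hS.epi_g
    exact HomologicalComplex.epi_homologyMap_of_epi_of_not_rel _ _ (by simp)
  have := isIso_of_mono_of_epi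
    (HomologicalComplex.homologyMap (coveringSequence X (ModuleCat.of ℚ ℚ)).g 0)
  exact congr_arg _ (rank_eq_of_iso (asIso
    (HomologicalComplex.homologyMap (coveringSequence X (ModuleCat.of ℚ ℚ)).g 0))).symm

/-- As 1 - τ acts as zero, the long exact sequence breaks into 0 → H_{k+1}(X × ℝ) → H_{k+1}(X × S¹)
→ H_k(X × ℝ) → 0. -/
lemma bettiNumber_prod_circle_succ (k : ℕ) :
    bettiNumber (X × Circle) (k + 1) = bettiNumber X (k + 1) + bettiNumber X k := by
  rw [← bettiNumber_prod_real X k, ← bettiNumber_prod_real X (k + 1)]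
  have hS := coveringSequence_shortExact X (ModuleCat.of ℚ ℚ)
  have hf (n) := homologyMap_coveringSequence_f X (ModuleCat.of ℚ ℚ) n
  have hrel : (ComplexShape.down ℕ).Rel (k + 1) k := rfl
  have := ModuleCat.rank_eq_add_of_exact _ _ _ (hS.homology_exact₃ (k + 1) k hrel)
    ((hS.homology_exact₂ (k + 1)).mono_g (hf _)) ((hS.homology_exact₁ _ _ hrel).epi_f (hf _))
  unfold bettiNumber
  rw [← map_add]
  exact congr_arg _ this

end

lemma bettiNumber_of_unique (X : Type) [TopologicalSpace X] [Unique X] (k : ℕ) :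
    bettiNumber X k = Nat.choose 0 k := by
  have : TotallyDisconnectedSpace (TopCat.of X) := inferInstanceAs (TotallyDisconnectedSpace X)
  unfold bettiNumber
  cases k with
  | zero =>
    have : Unique (TopCat.of X) := inferInstanceAs (Unique X)
    rw [rank_eq_of_iso (singularHomologyFunctorZeroOfTotallyDisconnectedSpace _ _ (TopCat.of X) ≪≫
      coproductUniqueIso _)]
    simp
  | succ k =>
    have h := isZero_singularHomologyFunctor_of_totallyDisconnectedSpace (ModuleCat.{0} ℚ) (k + 1)
      (ModuleCat.of ℚ ℚ) (TopCat.of X) (by omega)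
    have := ModuleCat.subsingleton_of_isZero h
    simp

lemma bettiNumber_torus (d k : ℕ) : bettiNumber (Fin d → Circle) k = d.choose k := by
  induction d generalizing k with
  | zero => exact bettiNumber_of_unique _ k
  | succ d ih =>
    have e : (Fin (d + 1) → Circle) ≃ₜ (Fin d → Circle) × Circle :=
      (Fin.appendHomeomorph d 1).symm.trans
        ((Homeomorph.refl _).prodCongr (Homeomorph.funUnique (Fin 1) Circle))
    rw [bettiNumber_congr e]
    cases k with
    | zero => rw [bettiNumber_prod_circle_zero, ih]; simp
    | succ k =>
      rw [bettiNumber_prod_circle_succ, ih, ih, Nat.choose_succ_succ, add_comm]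
      push_cast; rfl

lemma tsum_bettiNumber_torus (d : ℕ) : ∑' k, bettiNumber (Fin d → Circle) k = 2 ^ d := by
  rw [tsum_eq_sum (s := Finset.range (d + 1))]
  · simp only [bettiNumber_torus]
    exact_mod_cast Nat.sum_range_choose d
  · intro k hk
    rw [bettiNumber_torus, Nat.choose_eq_zero_of_lt (by simpa using hk)]
    rfl

end RobotArm

end

/-! ### The arm in complex coordinates -/

namespace RobotArm
open Complex ComplexConjugate

/-- The identification of the complex numbers with the Euclidean plane. -/
noncomputable def toPlane : ℂ ≃ₗᵢ[ℝ] Plane := Complex.orthonormalBasisOneI.repr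

@[simp] lemma toPlane_apply_zero (z : ℂ) : toPlane z 0 = z.re := by
  simp [toPlane, Complex.orthonormalBasisOneI_repr_apply]

@[simp] lemma toPlane_apply_one (z : ℂ) : toPlane z 1 = z.im := by
  simp [toPlane, Complex.orthonormalBasisOneI_repr_apply]

lemma toPlane_eq (z : ℂ) : toPlane z = !₂[z.re, z.im] := by
  ext i; fin_cases i <;> simp

lemma cross_toPlane (z w : ℂ) : cross (toPlane z) (toPlane w) = (conj z * w).im := by
  simp [cross]; ring

variable {n : ℕ} (l : Fin (n + 1) → ℝ)

/-- The vertices, as complex numbers, of the arm whose links have directions `z`. -/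
noncomputable def vertex (z : Fin (n + 1) → ℂ) (k : Fin (n + 2)) : ℂ :=
  ∑ i : Fin (n + 1) with i.castSucc < k, l i * z i

@[simp] lemma vertex_zero (z : Fin (n + 1) → ℂ) : vertex l z 0 = 0 := by
  simp [vertex]

lemma filter_castSucc_lt_succ (i : Fin (n + 1)) :
    (Finset.univ.filter fun j : Fin (n + 1) => j.castSucc < i.succ) =
      insert i (Finset.univ.filter fun j : Fin (n + 1) => j.castSucc < i.castSucc) := by
  ext j
  simp only [Finset.mem_filter, Finset.mem_univ, true_and, Finset.mem_insert,
    Fin.lt_def, Fin.ext_iff, Fin.val_castSucc, Fin.val_succ]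
  omega

lemma vertex_succ (z : Fin (n + 1) → ℂ) (i : Fin (n + 1)) :
    vertex l z i.succ = vertex l z i.castSucc + l i * z i := by
  rw [vertex, filter_castSucc_lt_succ, Finset.sum_insert (by simp), vertex, add_comm]

lemma vertex_one (z : Fin (n + 1) → ℂ) : vertex l z 1 = l 0 * z 0 := by
  have := vertex_succ l z 0
  simpa using this

lemma vertex_last (z : Fin (n + 1) → ℂ) : vertex l z (Fin.last _) = ∑ i, l i * z i := by
  simp [vertex, Fin.castSucc_lt_last]

/-- The arm whose links have directions `z`. -/
noncomputable def arm (z : Fin (n + 1) → ℂ) (k : Fin (n + 2)) : Plane :=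
  toPlane (vertex l z k)

variable {l} in
lemma arm_mem (hl : ∀ i, 0 < l i) {z : Fin (n + 1) → ℂ} (hz : ∀ i, ‖z i‖ = 1) (h0 : z 0 = 1) :
    arm l z ∈ moduliSpace l := by
  refine ⟨by simp [arm, toPlane_eq], by simp [arm, vertex_one, h0, toPlane_eq], fun i => ?_⟩
  rw [arm, arm, toPlane.dist_map, vertex_succ, dist_self_add_right, norm_mul, hz, mul_one,
    Complex.norm_real, Real.norm_of_nonneg (hl i).le]

/-- The directions of the links of an arm. -/
noncomputable def direction (R : Fin (n + 2) → Plane) (i : Fin (n + 1)) : ℂ :=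
  (toPlane.symm (R i.succ) - toPlane.symm (R i.castSucc)) / l i

variable {l} in
lemma direction_arm (hl : ∀ i, 0 < l i) (z : Fin (n + 1) → ℂ) : direction l (arm l z) = z := by
  ext i
  have := (hl i).ne'
  simp only [direction, arm, LinearIsometryEquiv.symm_apply_apply, vertex_succ, add_sub_cancel_left]
  field_simp [this]

variable {l} in
lemma direction_zero (hl : ∀ i, 0 < l i) {R : Fin (n + 2) → Plane} (hR : R ∈ moduliSpace l) :
    direction l R 0 = 1 := by
  have h0 : R 0 = toPlane 0 := by rw [hR.1, toPlane_eq]; simp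
  have h1 : R 1 = toPlane (l 0) := by rw [hR.2.1, toPlane_eq]; simp
  have := (hl 0).ne'
  simp [direction, h0, h1, this]

variable {l} in
lemma norm_direction (hl : ∀ i, 0 < l i) {R : Fin (n + 2) → Plane} (hR : R ∈ moduliSpace l)
    (i : Fin (n + 1)) : ‖direction l R i‖ = 1 := by
  rw [direction, norm_div, ← dist_eq_norm, toPlane.symm.dist_map, dist_comm, hR.2.2 i,
    Complex.norm_real, Real.norm_of_nonneg (hl i).le, div_self (hl i).ne']

variable {l} in
lemma arm_direction (hl : ∀ i, 0 < l i) {R : Fin (n + 2) → Plane} (hR : R ∈ moduliSpace l) :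
    arm l (direction l R) = R := by
  have h0 : R 0 = toPlane 0 := by rw [hR.1, toPlane_eq]; simp
  ext1 k
  induction k using Fin.induction with
  | zero => simp [arm, h0]
  | succ i ih =>
    have : (l i : ℂ) ≠ 0 := by exact_mod_cast (hl i).ne'
    rw [arm, vertex_succ, map_add, ← arm, ih, direction, mul_div_cancel₀ _ this, map_sub]
    simp

lemma armOfAngles_eq (β : Fin n → ℝ) :
    armOfAngles l β = arm l fun i => exp ((Fin.cons 0 β : Fin (n + 1) → ℝ) i * I) := by
  ext1 k
  rw [armOfAngles, arm, vertex, map_sum]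
  refine Finset.sum_congr rfl fun i _ => ?_
  rw [← Complex.real_smul, map_smul, toPlane_eq, Complex.exp_ofReal_mul_I_re,
    Complex.exp_ofReal_mul_I_im]

variable {l} in
lemma exists_armOfAngles (hl : ∀ i, 0 < l i) {R : Fin (n + 2) → Plane} (hR : R ∈ moduliSpace l) :
    ∃ β, armOfAngles l β = R := by
  refine ⟨fun j => (direction l R j.succ).arg, ?_⟩
  rw [armOfAngles_eq]
  conv_rhs => rw [← arm_direction hl hR]
  congr 1
  ext i
  cases i using Fin.cases with
  | zero => simp [direction_zero hl hR]
  | succ j =>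
    have := Complex.norm_mul_exp_arg_mul_I (direction l R j.succ)
    rw [norm_direction hl hR, ofReal_one, one_mul] at this
    simpa using this

variable {l} in
/-- The directions of the links identify the moduli space with a torus. -/
noncomputable def torusHomeomorph (hl : ∀ i, 0 < l i) : moduliSpace l ≃ₜ (Fin n → Circle) where
  toFun R j := ⟨direction l R.1 j.succ, mem_sphere_zero_iff_norm.2 (norm_direction hl R.2 _)⟩
  invFun z := ⟨arm l (Fin.cons 1 fun j => (z j : ℂ)), arm_mem hl (fun i => by
    cases i using Fin.cases <;> simp [Circle.norm_coe]) (by simp)⟩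
  left_inv R := by
    apply Subtype.ext
    simp only
    conv_rhs => rw [← arm_direction hl R.2]
    congr 1
    ext i
    cases i using Fin.cases with
    | zero => simp [direction_zero hl R.2]
    | succ j => simp
  right_inv z := by
    ext j
    simp [direction_arm hl]
  continuous_toFun := by
    refine continuous_pi fun j => Continuous.subtype_mk ?_ _
    unfold direction
    have h (k) : Continuous fun R : moduliSpace l => toPlane.symm (R.1 k) :=
      toPlane.symm.continuous.comp ((continuous_apply k).comp continuous_subtype_val)
    exact ((h _).sub (h _)).div_const _
  continuous_invFun := by
    refine Continuous.subtype_mk (continuous_pi fun k => ?_) _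
    unfold arm vertex
    refine toPlane.continuous.comp (continuous_finsetSum _ fun i _ => ?_)
    refine continuous_const.mul ?_
    cases i using Fin.cases with
    | zero => simpa using continuous_const
    | succ j =>
      have h : Continuous fun z : Fin n → Circle => (z j : ℂ) :=
        continuous_subtype_val.comp (continuous_apply j)
      simpa only [Fin.cons_succ] using h

lemma area_arm (z : Fin (n + 1) → ℂ) :
    area (arm l z) = (∑ i : Fin (n + 1), (conj (vertex l z i.castSucc) * (l i * z i)).im) / 2 := by
  rw [area, arm, arm, cross_toPlane]
  simp only [vertex_zero, mul_zero, Complex.zero_im, add_zero]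
  congr 1
  refine Finset.sum_congr rfl fun i _ => ?_
  rw [arm, arm, cross_toPlane, vertex_succ, mul_add, Complex.add_im, mul_comm (conj _),
    Complex.mul_conj]
  simp

end RobotArm

/-! ### Arms inscribed in a circle through the first two vertices -/

namespace RobotArm
open Complex ComplexConjugate

section
variable {n : ℕ} (l : Fin (n + 1) → ℝ)

/-- Half of the signed curvature of the circle through the first two vertices `0` and `l 0` whose
tangent direction at `l 0` is `u`. -/
noncomputable def halfCurvature (u : ℂ) : ℝ := u.im / l 0

/-- The equation of the circle, or line, through the first two vertices `0` and `l 0` whose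
tangent direction at `l 0` is `u`. -/
noncomputable def circleEq (u p : ℂ) : ℝ := halfCurvature l u * normSq p - (u * p).im

/-- The tangent direction at the point `p` of the circle of equation `circleEq l u`. -/
noncomputable def tangent (u p : ℂ) : ℂ := conj u + 2 * I * halfCurvature l u * p

@[simp] lemma circleEq_zero (u : ℂ) : circleEq l u 0 = 0 := by simp [circleEq]

lemma halfCurvature_neg (u : ℂ) : halfCurvature l (-u) = -halfCurvature l u := by
  simp [halfCurvature, neg_div]

lemma circleEq_neg (u p : ℂ) : circleEq l (-u) p = -circleEq l u p := by
  simp [circleEq, halfCurvature_neg]; ring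

lemma tangent_neg (u p : ℂ) : tangent l (-u) p = -tangent l u p := by
  simp [tangent, halfCurvature_neg]; ring

/-- Expanding the quadratic equation at p + az gives the chord–tangent relation: from a point of the
circle, a nonzero step stays on it exactly when the sine of its angle with the tangent is half the
curvature times its length. -/
lemma circleEq_add (u p z : ℂ) (hz : ‖z‖ = 1) (a : ℝ) :
    circleEq l u (p + a * z) =
      circleEq l u p + a * (halfCurvature l u * a - (conj (tangent l u p) * z).im) := by
  have h : z.re * z.re + z.im * z.im = 1 := by
    rw [← normSq_apply, normSq_eq_norm_sq, hz, one_pow]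
  simp only [tangent, circleEq, normSq_apply, add_re, add_im, mul_re, mul_im, conj_re, conj_im,
    I_re, I_im, ofReal_re, ofReal_im, re_ofNat, im_ofNat]
  linear_combination halfCurvature l u * a ^ 2 * h

/-- The rotation by half of the angle under which link number `i` is seen from the centre of the
circle on which it is inscribed. -/
noncomputable def halfTurn (ε : Fin (n + 1) → ℝ) (u : ℂ) : Fin (n + 1) → ℂ :=
  Fin.cases u fun i => √(1 - (halfCurvature l u * l i.succ) ^ 2) +
    ε i.succ * halfCurvature l u * l i.succ * I

/-- The tangent directions at the vertices of the inscribed arm. -/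
noncomputable def turning (ε : Fin (n + 1) → ℝ) (u : ℂ) (k : Fin (n + 2)) : ℂ :=
  conj u * ∏ i : Fin (n + 1) with i.castSucc < k, halfTurn l ε u i ^ 2

/-- The directions of the links of the arm inscribed in the circle of tangent direction `u`, with
orientations `ε` of the links. -/
noncomputable def inscribedDirection (ε : Fin (n + 1) → ℝ) (u : ℂ) (i : Fin (n + 1)) : ℂ :=
  ε i * turning l ε u i.castSucc * halfTurn l ε u i

@[simp] lemma halfTurn_zero (ε : Fin (n + 1) → ℝ) (u : ℂ) : halfTurn l ε u 0 = u := rfl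

lemma halfTurn_succ (ε : Fin (n + 1) → ℝ) (u : ℂ) (i : Fin n) :
    halfTurn l ε u i.succ = √(1 - (halfCurvature l u * l i.succ) ^ 2) +
      ε i.succ * halfCurvature l u * l i.succ * I := rfl

@[simp] lemma turning_zero (ε : Fin (n + 1) → ℝ) (u : ℂ) : turning l ε u 0 = conj u := by
  simp [turning]

lemma turning_succ (ε : Fin (n + 1) → ℝ) (u : ℂ) (i : Fin (n + 1)) :
    turning l ε u i.succ = turning l ε u i.castSucc * halfTurn l ε u i ^ 2 := by
  rw [turning, filter_castSucc_lt_succ, Finset.prod_insert (by simp), turning]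
  ring

variable {l} (hl : ∀ i, 0 < l i) (hmax : ∀ i, i ≠ 0 → l i < l 0) {ε : Fin (n + 1) → ℝ}
  (hε : ∀ i, ε i * ε i = 1) (hε0 : ε 0 = 1) {u : ℂ} (hu : ‖u‖ = 1)

section
include hl hmax hu

/-- Half the curvature is the inverse of the diameter, up to sign, and the diameter is at least `l
0`. This is where the first link must be the longest. -/
lemma sq_halfCurvature_mul_lt_one (i : Fin n) : (halfCurvature l u * l i.succ) ^ 2 < 1 := by
  have h0 := hl 0
  have h1 : u.im ^ 2 ≤ 1 := by
    have := Complex.abs_im_le_norm u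
    rw [hu] at this
    exact (sq_le_one_iff_abs_le_one _).2 this
  have h2 : l i.succ ^ 2 < l 0 ^ 2 :=
    pow_lt_pow_left₀ (hmax _ (Fin.succ_ne_zero i)) (hl _).le two_ne_zero
  rw [halfCurvature, div_mul_eq_mul_div, div_pow, div_lt_one (by positivity), mul_pow]
  nlinarith [sq_nonneg (l i.succ), sq_nonneg u.im]

lemma halfTurn_succ_re_pos (i : Fin n) : 0 < (halfTurn l ε u i.succ).re := by
  have := sq_halfCurvature_mul_lt_one hl hmax hu i
  simp only [halfTurn_succ, add_re, mul_re, mul_im, I_re, I_im, ofReal_re, ofReal_im]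
  simp only [mul_zero, zero_mul, sub_zero, mul_one, add_zero, sub_self]
  exact Real.sqrt_pos.2 (by linarith)

include hε

lemma norm_halfTurn (i : Fin (n + 1)) : ‖halfTurn l ε u i‖ = 1 := by
  cases i using Fin.cases with
  | zero => simpa using hu
  | succ i =>
    have := sq_halfCurvature_mul_lt_one hl hmax hu i
    have h := Real.sq_sqrt (show 0 ≤ 1 - (halfCurvature l u * l i.succ) ^ 2 by linarith)
    rw [← sq_eq_sq₀ (norm_nonneg _) zero_le_one, ← normSq_eq_norm_sq, normSq_apply]
    simp only [halfTurn_succ, add_re, add_im, mul_re, mul_im, I_re, I_im, ofReal_re, ofReal_im]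
    linear_combination h + (halfCurvature l u * l i.succ) ^ 2 * hε i.succ

lemma norm_turning (k : Fin (n + 2)) : ‖turning l ε u k‖ = 1 := by
  simp [turning, norm_prod, norm_halfTurn hl hmax hε hu, hu]

lemma norm_inscribedDirection (i : Fin (n + 1)) : ‖inscribedDirection l ε u i‖ = 1 := by
  have : |ε i| = 1 := by
    rcases mul_self_eq_one_iff.1 (hε i) with h | h <;> simp [h]
  simp [inscribedDirection, norm_halfTurn hl hmax hε hu, norm_turning hl hmax hε hu, this]
end

include hε0 in
lemma halfTurn_im (h0 : l 0 ≠ 0) (i : Fin (n + 1)) :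
    (halfTurn l ε u i).im = ε i * halfCurvature l u * l i := by
  cases i using Fin.cases with
  | zero => simp [hε0, halfCurvature, h0]
  | succ i => simp [halfTurn_succ]

include hε0 hu in
lemma inscribedDirection_zero : inscribedDirection l ε u 0 = 1 := by
  have : conj u * u = 1 := by rw [mul_comm, mul_conj, normSq_eq_norm_sq, hu]; simp
  simp [inscribedDirection, hε0, this]

include hl hmax hε hu in
lemma conj_turning_mul (i : Fin (n + 1)) :
    conj (turning l ε u i.castSucc) * inscribedDirection l ε u i = ε i * halfTurn l ε u i := by
  have : turning l ε u i.castSucc * conj (turning l ε u i.castSucc) = 1 := by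
    rw [mul_conj, normSq_eq_norm_sq, norm_turning hl hmax hε hu]; simp
  rw [inscribedDirection]
  linear_combination ε i * halfTurn l ε u i * this

include hl hmax hε hε0 hu

/-- Along a chord the tangent turns by twice the chord–tangent angle; algebraically, h² - 1 = 2i h
Im h for a unit h. -/
lemma turning_eq (k : Fin (n + 2)) :
    turning l ε u k = tangent l u (vertex l (inscribedDirection l ε u) k) := by
  induction k using Fin.induction with
  | zero => simp [tangent]
  | succ i ih =>
    have h1 : halfTurn l ε u i * conj (halfTurn l ε u i) = 1 := by
      rw [mul_conj, normSq_eq_norm_sq, norm_halfTurn hl hmax hε hu]; simp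
    have h2 : halfTurn l ε u i - conj (halfTurn l ε u i) =
        2 * I * (ε i * halfCurvature l u * l i) := by
      rw [sub_conj, halfTurn_im hε0 (hl 0).ne']; push_cast; ring
    rw [turning_succ, vertex_succ]
    have h3 : tangent l u (vertex l (inscribedDirection l ε u) i.castSucc +
        l i * inscribedDirection l ε u i) = turning l ε u i.castSucc +
          2 * I * halfCurvature l u * (l i * inscribedDirection l ε u i) := by
      rw [ih]; simp [tangent]; ring
    rw [h3, inscribedDirection]
    linear_combination turning l ε u i.castSucc * h1 +
      turning l ε u i.castSucc * halfTurn l ε u i * h2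

lemma circleEq_vertex (k : Fin (n + 2)) :
    circleEq l u (vertex l (inscribedDirection l ε u) k) = 0 := by
  induction k using Fin.induction with
  | zero => simp
  | succ i ih =>
    rw [vertex_succ, circleEq_add l u _ _ (norm_inscribedDirection hl hmax hε hu i), ih,
      ← turning_eq hl hmax hε hε0 hu, conj_turning_mul hl hmax hε hu, im_ofReal_mul,
      halfTurn_im hε0 (hl 0).ne']
    linear_combination -l i * (halfCurvature l u * l i) * hε i

end

section
variable {n : ℕ} {l : Fin (n + 1) → ℝ} (hl : ∀ i, 0 < l i) (hmax : ∀ i, i ≠ 0 → l i < l 0)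
  {z : Fin (n + 1) → ℂ} (hz : ∀ i, ‖z i‖ = 1) (hz0 : z 0 = 1) {u : ℂ} (hu : ‖u‖ = 1)
  (h : ∀ k, circleEq l u (vertex l z k) = 0)

variable (l z u) in
/-- The sign of the component of link number `i` along the tangent of the circle. -/
noncomputable def orientation : Fin (n + 1) → ℝ :=
  Fin.cases 1 fun i =>
    if 0 < (conj (tangent l u (vertex l z i.succ.castSucc)) * z i.succ).re then 1 else -1

lemma orientation_mul_self (i : Fin (n + 1)) : orientation l z u i * orientation l z u i = 1 := by
  cases i using Fin.cases with
  | zero => simp [orientation]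
  | succ i => simp only [orientation, Fin.cases_succ]; split_ifs <;> norm_num

include hl hmax hz hz0 hu h

/-- An arm inscribed in the circle of tangent direction `u` is determined by the orientations of
its links. -/
lemma inscribedDirection_orientation : inscribedDirection l (orientation l z u) u = z := by
  have step (i : Fin (n + 1)) (hi : vertex l (inscribedDirection l (orientation l z u) u)
      i.castSucc = vertex l z i.castSucc) :
      inscribedDirection l (orientation l z u) u i = z i := by
    have hT := turning_eq hl hmax orientation_mul_self rfl hu (ε := orientation l z u) i.castSucc
    rw [hi] at hT
    have hT1 := norm_turning hl hmax orientation_mul_self hu (ε := orientation l z u) i.castSucc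
    have hTT : turning l (orientation l z u) u i.castSucc *
        conj (turning l (orientation l z u) u i.castSucc) = 1 := by
      rw [mul_conj, normSq_eq_norm_sq, hT1]; simp
    suffices hw : conj (turning l (orientation l z u) u i.castSucc) * z i =
        orientation l z u i * halfTurn l (orientation l z u) u i by
      rw [inscribedDirection]
      linear_combination z i * hTT - turning l (orientation l z u) u i.castSucc * hw
    cases i using Fin.cases with
    | zero => simp [hz0, orientation]
    | succ i =>
      -- Both ends of the link lie on the circle, so the component normal to the tangent is forced;
      -- only the sign of the tangential component remains free.
      have him := circleEq_add l u (vertex l z i.succ.castSucc) _ (hz i.succ) (l i.succ)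
      rw [← vertex_succ, h, h, zero_add, eq_comm, mul_eq_zero, or_iff_right (hl _).ne', ← hT,
        sub_eq_zero, eq_comm] at him
      have hsign : orientation l z u i.succ =
          if 0 < (conj (turning l (orientation l z u) u i.succ.castSucc) * z i.succ).re
          then 1 else -1 := by
        rw [hT]; rfl
      generalize hw : conj (turning l (orientation l z u) u i.succ.castSucc) * z i.succ = w
        at him hsign ⊢
      have hw1 : w.re * w.re + w.im * w.im = 1 := by
        rw [← normSq_apply, normSq_eq_norm_sq, ← hw, norm_mul, norm_conj, hT1, hz]; norm_num
      have hre : √(1 - (halfCurvature l u * l i.succ) ^ 2) = |w.re| := by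
        rw [← Real.sqrt_sq_eq_abs]; congr 1; rw [← him]; linear_combination -hw1
      have hε := orientation_mul_self (l := l) (z := z) (u := u) i.succ
      rw [halfTurn_succ, hre]
      apply Complex.ext
      · simp only [add_re, mul_re, mul_im, I_re, I_im, ofReal_re, ofReal_im, add_im]
        rw [hsign]
        split_ifs with h0
        · rw [abs_of_pos h0]; ring
        · rw [abs_of_nonpos (not_lt.1 h0)]; ring
      · simp only [add_re, mul_re, mul_im, I_re, I_im, ofReal_re, ofReal_im, add_im]
        rw [him]
        linear_combination -(halfCurvature l u * l i.succ) * hε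
  have key (k : Fin (n + 2)) :
      vertex l (inscribedDirection l (orientation l z u) u) k = vertex l z k := by
    induction k using Fin.induction with
    | zero => simp
    | succ i ih => rw [vertex_succ, vertex_succ, ih, step i ih]
  exact funext fun i => step i (key _)

end

end RobotArm

/-! ### Quasicyclic configurations and their parametrisation -/

namespace RobotArm
open Complex ComplexConjugate

section
variable {n : ℕ} {l : Fin (n + 1) → ℝ} {z : Fin (n + 1) → ℂ}

lemma isAligned_arm_iff (h0 : l 0 ≠ 0) (hz0 : z 0 = 1) :
    IsAligned (arm l z) ↔ ∀ k, (vertex l z k).im = 0 := by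
  have h0' : (0 : Plane) ∈ Set.range (arm l z) := ⟨0, by simp [arm]⟩
  rw [IsAligned, collinear_iff_of_mem h0']
  constructor
  · rintro ⟨v, hv⟩ k
    obtain ⟨r, hr⟩ := hv _ ⟨k, rfl⟩
    obtain ⟨r₁, hr₁⟩ := hv _ ⟨1, rfl⟩
    simp only [vadd_eq_add, add_zero] at hr hr₁
    have hv1 : v 1 = 0 := by
      have e0 := congr_arg (fun p : Plane => p 0) hr₁
      have e1 := congr_arg (fun p : Plane => p 1) hr₁
      simp [arm, vertex_one, hz0] at e0 e1
      rcases e1 with e1 | e1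
      · rw [e1, zero_mul] at e0; exact absurd e0 h0
      · exact e1
    have := congr_arg (fun p : Plane => p 1) hr
    simpa [arm, hv1] using this
  · intro h
    refine ⟨toPlane 1, ?_⟩
    rintro _ ⟨k, rfl⟩
    refine ⟨(vertex l z k).re, ?_⟩
    rw [vadd_eq_add, add_zero, ← map_smul, arm]
    congr 1
    apply Complex.ext <;> simp [h k]

lemma isCyclic_arm_iff : IsCyclic (arm l z) ↔
    ∃ (c : ℂ) (ρ : ℝ), 0 < ρ ∧ ∀ k, ‖vertex l z k - c‖ = ρ := by
  constructor
  · rintro ⟨c, ρ, hρ, h⟩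
    refine ⟨toPlane.symm c, ρ, hρ, fun k => ?_⟩
    rw [← h k, arm, ← dist_eq_norm, ← toPlane.dist_map, LinearIsometryEquiv.apply_symm_apply]
  · rintro ⟨c, ρ, hρ, h⟩
    refine ⟨toPlane c, ρ, hρ, fun k => ?_⟩
    rw [← h k, arm, toPlane.dist_map, dist_eq_norm]

lemma norm_vertex_sub_eq_iff (c p : ℂ) : ‖p - c‖ = ‖c‖ ↔ normSq p = 2 * (conj c * p).re := by
  rw [← sq_eq_sq₀ (norm_nonneg _) (norm_nonneg _), ← normSq_eq_norm_sq, ← normSq_eq_norm_sq]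
  simp only [normSq_apply, sub_re, sub_im, mul_re, conj_re, conj_im]
  constructor <;> intro h <;> linear_combination h

lemma isQuasicyclic_arm_iff (h0 : 0 < l 0) (hz0 : z 0 = 1) :
    IsQuasicyclic (arm l z) ↔ ∃ u : ℂ, ‖u‖ = 1 ∧ ∀ k, circleEq l u (vertex l z k) = 0 := by
  rw [IsQuasicyclic, isAligned_arm_iff h0.ne' hz0, isCyclic_arm_iff]
  constructor
  · rintro (⟨c, ρ, hρ, h⟩ | h)
    · have hc : ‖c‖ = ρ := by have := h 0; simpa using this
      simp_rw [← hc, norm_vertex_sub_eq_iff] at h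
      have h1 := h 1
      rw [vertex_one, hz0, mul_one, normSq_ofReal, re_mul_ofReal, conj_re, ← mul_assoc] at h1
      replace h1 := mul_right_cancel₀ h0.ne' h1
      have hρ' : (ρ : ℂ) ≠ 0 := by exact_mod_cast hρ.ne'
      -- The unit tangent at `l 0` to the circle of centre c and radius ρ; it uses Re c = l 0 / 2.
      refine ⟨I * conj c / ρ, ?_, fun k => ?_⟩
      · rw [norm_div, norm_mul, norm_conj, hc, norm_I, one_mul, norm_real, Real.norm_of_nonneg hρ.le,
          div_self hρ.ne']
      · have e1 : (I * conj c / ρ).im = c.re / ρ := by simp [div_ofReal_im]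
        have e2 : (I * conj c / ρ * vertex l z k).im = (conj c * vertex l z k).re / ρ := by
          rw [div_mul_eq_mul_div, div_ofReal_im, mul_assoc, I_mul_im]
        have hc0 : c.re ≠ 0 := by rintro hc0; simp [hc0, h0.ne'] at h1
        rw [circleEq, halfCurvature, e1, e2, h k, h1]
        field_simp
        ring
    · exact ⟨1, by simp, fun k => by simp [circleEq, halfCurvature, h k]⟩
  · rintro ⟨u, hu, h⟩
    by_cases hκ : u.im = 0
    · right
      intro k
      have hk := h k
      have hu' : u.re * u.re + u.im * u.im = 1 := by
        rw [← normSq_apply, normSq_eq_norm_sq, hu, one_pow]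
      have hre : u.re ≠ 0 := by rintro h; simp [h, hκ] at hu'
      simpa [circleEq, halfCurvature, hκ, hre] using hk
    · left
      have hκ' : halfCurvature l u ≠ 0 := div_ne_zero hκ h0.ne'
      -- The centre, found by solving `tangent l u c = 0`.
      set c : ℂ := I * conj u / (2 * halfCurvature l u : ℝ) with hc
      have hcu : ‖c‖ ≠ 0 := by
        rw [norm_ne_zero_iff]
        refine div_ne_zero (mul_ne_zero I_ne_zero ?_) (by exact_mod_cast mul_ne_zero two_ne_zero hκ')
        rw [← norm_ne_zero_iff, norm_conj, hu]; exact one_ne_zero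
      refine ⟨c, ‖c‖, lt_of_le_of_ne (norm_nonneg _) hcu.symm, fun k => ?_⟩
      rw [norm_vertex_sub_eq_iff]
      have e : (conj c * vertex l z k).re = (u * vertex l z k).im / (2 * halfCurvature l u) := by
        rw [hc, map_div₀, map_mul, conj_I, conj_conj, conj_ofReal, div_mul_eq_mul_div, div_ofReal_re,
          mul_assoc, neg_mul, neg_re, I_mul_re, neg_neg]
      have hk := h k
      rw [circleEq, sub_eq_zero] at hk
      rw [e, ← hk]
      field_simp

end

section
variable {n : ℕ} {l : Fin (n + 1) → ℝ} (hl : ∀ i, 0 < l i) (hmax : ∀ i, i ≠ 0 → l i < l 0)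

/-- The family of configurations inscribed in circles, with given orientations of the links. -/
noncomputable def inscribedArm {ε : Fin (n + 1) → ℝ} (hε : ∀ i, ε i * ε i = 1) (hε0 : ε 0 = 1)
    (u : Circle) : moduliSpace l :=
  ⟨arm l (inscribedDirection l ε u), arm_mem hl
    (norm_inscribedDirection hl hmax hε u.norm_coe) (inscribedDirection_zero hε0 u.norm_coe)⟩

variable {ε : Fin (n + 1) → ℝ} (hε : ∀ i, ε i * ε i = 1) (hε0 : ε 0 = 1)

lemma continuous_halfTurn (i : Fin (n + 1)) :
    Continuous fun u : Circle => halfTurn l ε (u : ℂ) i := by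
  cases i using Fin.cases with
  | zero => exact continuous_subtype_val
  | succ i =>
    have h : Continuous fun u : Circle => halfCurvature l (u : ℂ) :=
      (Complex.continuous_im.comp continuous_subtype_val).div_const _
    simp only [halfTurn_succ]
    fun_prop

lemma continuous_turning (k : Fin (n + 2)) :
    Continuous fun u : Circle => turning l ε (u : ℂ) k := by
  unfold turning
  exact (Complex.continuous_conj.comp continuous_subtype_val).mul
    (continuous_finsetProd _ fun i _ => (continuous_halfTurn i).pow 2)

lemma continuous_inscribedArm : Continuous (inscribedArm hl hmax hε hε0) := by
  refine Continuous.subtype_mk (continuous_pi fun k => ?_) _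
  unfold arm vertex
  refine toPlane.continuous.comp (continuous_finsetSum _ fun i _ => continuous_const.mul ?_)
  exact (continuous_const.mul (continuous_turning _)).mul (continuous_halfTurn i)

lemma inscribedDirection_one {l : Fin (n + 2) → ℝ} {ε : Fin (n + 2) → ℝ} (hε1 : ε 1 = 1) {u : ℂ}
    (hu : ‖u‖ = 1) : inscribedDirection l ε u 1 = u * halfTurn l ε u 1 := by
  have h := turning_succ l ε u 0
  have hcu : conj u * u = 1 := by rw [mul_comm, mul_conj, normSq_eq_norm_sq, hu]; simp
  have h1 : turning l ε u (Fin.castSucc 1) = u := by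
    change turning l ε u (Fin.succ 0) = u
    rw [h]
    simp only [Fin.castSucc_zero, turning_zero, halfTurn_zero]
    linear_combination u * hcu
  rw [inscribedDirection, h1, hε1]
  simp

lemma eq_of_mul_ofReal_eq {u v : ℂ} (hu : ‖u‖ = 1) (hv : ‖v‖ = 1) {a b : ℝ} (ha : 0 < a)
    (hb : 0 < b) (h : a * u = b * v) : u = v := by
  have hab := congr_arg norm h
  rw [norm_mul, norm_mul, hu, hv, mul_one, mul_one, norm_real, norm_real,
    Real.norm_of_nonneg ha.le, Real.norm_of_nonneg hb.le] at hab
  rw [hab] at h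
  exact mul_left_cancel₀ (by exact_mod_cast hb.ne') h

/-- The second link has direction u h with h its half turn. With ρ = l 1 / l 0, the imaginary parts
of h and of ρ times the conjugate of u cancel, so u h + ρ is a real multiple of u, positive since ρ
< 1. Hence the second link alone determines u. -/
lemma exists_pos_mul_eq {l : Fin (n + 2) → ℝ} (hl : ∀ i, 0 < l i)
    (hmax : ∀ i, i ≠ 0 → l i < l 0) {ε : Fin (n + 2) → ℝ} (hε1 : ε 1 = 1) {u : ℂ}
    (hu : ‖u‖ = 1) :
    ∃ a : ℝ, 0 < a ∧ a * u = inscribedDirection l ε u 1 + (l 1 / l 0 : ℝ) := by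
  have hρ : (l 1 / l 0) ^ 2 < 1 := by
    rw [div_pow, div_lt_one (pow_pos (hl 0) 2)]
    exact pow_lt_pow_left₀ (hmax 1 (by simp)) (hl 1).le two_ne_zero
  have hcu : u * conj u = 1 := by rw [mul_conj, normSq_eq_norm_sq, hu]; simp
  have hu' : u.re * u.re + u.im * u.im = 1 := by
    rw [← normSq_apply, normSq_eq_norm_sq, hu, one_pow]
  have hs : halfTurn l ε u 1 = √(1 - (u.im * (l 1 / l 0)) ^ 2) + u.im * (l 1 / l 0 : ℝ) * I := by
    change halfTurn l ε u (Fin.succ 0) = _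
    rw [halfTurn_succ]
    simp only [Fin.succ_zero_eq_one, hε1, halfCurvature]
    push_cast
    have : u.im / l 0 * l 1 = u.im * (l 1 / l 0) := by ring
    rw [this]
    ring
  refine ⟨√(1 - (u.im * (l 1 / l 0)) ^ 2) + u.re * (l 1 / l 0), ?_, ?_⟩
  · have h1 : -(u.re * (l 1 / l 0)) < √(1 - (u.im * (l 1 / l 0)) ^ 2) := by
      apply Real.lt_sqrt_of_sq_lt
      nlinarith
    linarith
  · rw [inscribedDirection_one hε1 hu, hs]
    have e : u.re - u.im * I = conj u := by apply Complex.ext <;> simp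
    push_cast
    linear_combination (l 1 / l 0 : ℂ) * hcu + (l 1 / l 0 : ℂ) * u * e
end

end RobotArm

/-! ### Critical points of the area -/

namespace RobotArm
open Complex ComplexConjugate

section
variable {n : ℕ} (l : Fin (n + 1) → ℝ)

/-- The direction angle of link number `i`, as a linear function of the angle coordinates. -/
noncomputable def linkAngle (i : Fin (n + 1)) : (Fin n → ℝ) →L[ℝ] ℝ :=
  Fin.cases 0 (fun j => ContinuousLinearMap.proj j) i

lemma linkAngle_apply (i : Fin (n + 1)) (β : Fin n → ℝ) :
    linkAngle i β = (Fin.cons 0 β : Fin (n + 1) → ℝ) i := by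
  cases i using Fin.cases <;> simp [linkAngle]

/-- The directions of the links in the angle coordinates. -/
noncomputable def linkDirection (β : Fin n → ℝ) (i : Fin (n + 1)) : ℂ :=
  exp (linkAngle i β * I)

lemma armOfAngles_eq_arm (β : Fin n → ℝ) : armOfAngles l β = arm l (linkDirection β) := by
  rw [armOfAngles_eq]
  congr 1
  ext i
  rw [linkDirection, linkAngle_apply]

lemma conj_linkDirection_mul (β : Fin n → ℝ) (i j : Fin (n + 1)) :
    conj (linkDirection β j) * linkDirection β i =
      exp ((linkAngle i β - linkAngle j β : ℝ) * I) := by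
  rw [linkDirection, linkDirection, ← exp_conj, ← exp_add]
  congr 1
  simp
  ring

lemma areaOfAngles_eq (β : Fin n → ℝ) :
    areaOfAngles l β = (∑ i : Fin (n + 1), ∑ j : Fin (n + 1) with j.castSucc < i.castSucc,
      l i * l j * Real.sin (linkAngle i β - linkAngle j β)) / 2 := by
  rw [areaOfAngles, armOfAngles_eq_arm, area_arm]
  congr 1
  refine Finset.sum_congr rfl fun i _ => ?_
  rw [vertex, map_sum, Finset.sum_mul, im_sum]
  refine Finset.sum_congr rfl fun j _ => ?_
  rw [map_mul, conj_ofReal, mul_mul_mul_comm, conj_linkDirection_mul, ← ofReal_mul, im_ofReal_mul,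
    exp_ofReal_mul_I_im, mul_comm (l j)]

/-- The partial derivative of twice the area with respect to the angle of link number `i`. -/
noncomputable def areaGradient (z : Fin (n + 1) → ℂ) (i : Fin (n + 1)) : ℝ :=
  (conj (vertex l z i.castSucc + vertex l z i.succ - vertex l z (Fin.last _)) * (l i * z i)).re

/-- The sum of the two end vertices of a link minus the last vertex equals the links before it minus
the links after it. -/
lemma areaGradient_eq (z : Fin (n + 1) → ℂ) (i : Fin (n + 1)) :
    areaGradient l z i =
      ∑ j : Fin (n + 1), ((if j < i then l i * l j * (conj (z j) * z i).re else 0) -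
        if i < j then l i * l j * (conj (z j) * z i).re else 0) := by
  have h : vertex l z i.castSucc + vertex l z i.succ - vertex l z (Fin.last _) =
      ∑ j, ((if j < i then l j * z j else 0) - if i < j then l j * z j else 0) := by
    rw [vertex_last, vertex, vertex, Finset.sum_filter, Finset.sum_filter, ← Finset.sum_add_distrib,
      ← Finset.sum_sub_distrib]
    refine Finset.sum_congr rfl fun j _ => ?_
    simp only [Fin.castSucc_lt_castSucc_iff, Fin.castSucc_lt_succ_iff]
    rcases lt_trichotomy i j with hij | rfl | hij
    · simp [hij, hij.not_gt, hij.not_ge]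
    · simp
    · simp [hij, hij.not_gt, hij.le]
  rw [areaGradient, h, map_sum, Finset.sum_mul, re_sum]
  refine Finset.sum_congr rfl fun j _ => ?_
  rcases lt_trichotomy i j with hij | rfl | hij
  · simp [hij, hij.not_gt]; ring
  · simp
  · simp [hij, hij.not_gt]; ring

lemma sum_mul_eq_sum_filter_lt {N : ℕ} (a : Fin N → Fin N → ℝ) (ha : ∀ i j, a i j = a j i)
    (p : Fin N → ℝ) :
    ∑ i, (∑ j, ((if j < i then a i j else 0) - if i < j then a i j else 0)) * p i =
      ∑ i, ∑ j with j < i, a i j * (p i - p j) := by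
  have h : ∑ i, ∑ j, (if i < j then a i j * p i else 0) =
      ∑ i, ∑ j, if j < i then a i j * p j else 0 := by
    rw [Finset.sum_comm]
    simp only [ha]
  simp only [Finset.sum_filter, mul_sub, Finset.sum_mul, sub_mul, ite_mul, zero_mul,
    Finset.sum_sub_distrib, h]

lemma hasFDerivAt_areaOfAngles (β : Fin n → ℝ) :
    HasFDerivAt (areaOfAngles l)
      ((2⁻¹ : ℝ) • ∑ i, areaGradient l (linkDirection β) i • linkAngle i) β := by
  have h (i : Fin (n + 1)) : HasFDerivAt (fun β => linkAngle i β) (linkAngle i) β :=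
    (linkAngle i).hasFDerivAt
  have h1 := (HasFDerivAt.fun_sum (u := Finset.univ) fun (i : Fin (n + 1)) _ =>
    HasFDerivAt.fun_sum (u := Finset.univ.filter fun j : Fin (n + 1) => j.castSucc < i.castSucc)
      fun j _ => (((h i).sub (h j)).sin.const_mul (l i * l j))).const_mul (2⁻¹ : ℝ)
  refine (h1.congr_fderiv ?_).congr_of_eventuallyEq (.of_forall fun β => ?_)
  · have hre (i j : Fin (n + 1)) : (conj (linkDirection β j) * linkDirection β i).re =
        Real.cos (linkAngle i β - linkAngle j β) := by
      rw [conj_linkDirection_mul, exp_ofReal_mul_I_re]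
    ext v
    simp only [areaGradient_eq, hre, smul_apply, sum_apply,
      sub_apply, smul_eq_mul, Pi.sub_apply]
    congr 1
    rw [sum_mul_eq_sum_filter_lt _ (fun i j => by rw [← Real.cos_neg, neg_sub]; ring)]
    simp only [Fin.castSucc_lt_castSucc_iff, mul_assoc]
  · rw [areaOfAngles_eq, div_eq_inv_mul]
    rfl

lemma isCriticalPoint_iff (hl : ∀ i, 0 < l i) (R : moduliSpace l) :
    IsCriticalPoint l R ↔ ∀ i, areaGradient l (direction l R.1) (Fin.succ i) = 0 := by
  have key (β : Fin n → ℝ) (h : armOfAngles l β = R) :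
      HasFDerivAt (areaOfAngles l) (0 : (Fin n → ℝ) →L[ℝ] ℝ) β ↔
        ∀ i, areaGradient l (direction l R.1) (Fin.succ i) = 0 := by
    rw [← h, armOfAngles_eq_arm, direction_arm hl]
    have hD := hasFDerivAt_areaOfAngles l β
    rw [Fin.sum_univ_succ] at hD
    have h0 : linkAngle (0 : Fin (n + 1)) = 0 := rfl
    rw [h0, smul_zero, zero_add] at hD
    constructor
    · intro h i
      have := congr_arg (fun L : (Fin n → ℝ) →L[ℝ] ℝ => L (Pi.single i 1)) (hD.unique h)
      simpa [linkAngle, Pi.single_apply] using this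
    · intro h
      simpa [h] using hD
  constructor
  · rintro ⟨β, h, hβ⟩
    exact (key β h).1 hβ
  · intro h
    obtain ⟨β, hβ⟩ := exists_armOfAngles hl R.2
    exact ⟨β, hβ, (key β hβ).2 h⟩

/-- The critical points of the area are the arms inscribed in a circle of which the segment from
the first to the last vertex is a diameter. -/
lemma isCriticalPoint_iff_diacyclic (hl : ∀ i, 0 < l i) (R : moduliSpace l) :
    IsCriticalPoint l R ↔ ∀ k, normSq (vertex l (direction l R.1) k) =
      (conj (vertex l (direction l R.1) (Fin.last _)) * vertex l (direction l R.1) k).re := by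
  rw [isCriticalPoint_iff l hl]
  set z := direction l R.1
  set g : Fin (n + 2) → ℝ := fun k =>
    normSq (vertex l z k) - (conj (vertex l z (Fin.last _)) * vertex l z k).re with hg
  -- The gradient is a discrete derivative of `g`, whose vanishing is Thales' condition for the
  -- diameter from first to last vertex.
  have hgrad (i : Fin (n + 1)) : areaGradient l z i = g i.succ - g i.castSucc := by
    have : (l i * z i : ℂ) = vertex l z i.succ - vertex l z i.castSucc := by
      rw [vertex_succ]; ring
    rw [areaGradient, this, hg]
    simp only [normSq_apply, map_sub, map_add, add_re, sub_re, mul_re, sub_im, add_im, conj_re,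
      conj_im]
    ring
  have hlast : g (Fin.last _) = 0 := by
    simp [hg, normSq_apply]
  have h0 : g 0 = 0 := by simp [hg]
  trans ∀ k, g k = 0
  · constructor
    · intro h k
      -- The first link is fixed and gives no equation, so the descent stops at vertex 1; at vertex
      -- 0 the function `g` vanishes anyway.
      induction k using Fin.reverseInduction with
      | last => exact hlast
      | cast i ih =>
        cases i using Fin.cases with
        | zero => exact h0
        | succ i =>
          have := h i
          rw [hgrad, ih] at this
          linarith
    · intro h i
      rw [hgrad, h, h, sub_zero]
  · simp only [hg, sub_eq_zero]

lemma IsCriticalPoint.isQuasicyclic {l : Fin (n + 1) → ℝ} (hl : ∀ i, 0 < l i) {R : moduliSpace l}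
    (hR : IsCriticalPoint l R) : IsQuasicyclic R.1 := by
  left
  have h := (isCriticalPoint_iff_diacyclic l hl R).1 hR
  rw [← arm_direction hl R.2, isCyclic_arm_iff]
  have h1 := h 1
  have hz0 := direction_zero hl R.2
  set z := direction l R.1
  have hne : vertex l z (Fin.last _) ≠ 0 := by
    intro h0
    rw [h0, map_zero, zero_mul, zero_re, map_eq_zero, vertex_one, hz0, mul_one] at h1
    exact (hl 0).ne' (by exact_mod_cast h1)
  refine ⟨vertex l z (Fin.last _) / 2, ‖vertex l z (Fin.last _) / 2‖,
    norm_pos_iff.2 (div_ne_zero hne two_ne_zero), fun k => ?_⟩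
  rw [norm_vertex_sub_eq_iff, h k, map_div₀, conj_ofNat, div_mul_eq_mul_div, div_ofNat_re]
  ring

/-- As W has norm 1, Re W = 0 means W² = -1. Then the tangents at the first and last vertices are
opposite, so these vertices are antipodal. -/
lemma isCriticalPoint_of_re_prod_eq_zero {l : Fin (n + 1) → ℝ} (hl : ∀ i, 0 < l i)
    (hmax : ∀ i, i ≠ 0 → l i < l 0) {ε : Fin (n + 1) → ℝ} (hε : ∀ i, ε i * ε i = 1)
    (hε0 : ε 0 = 1) (u : Circle) (hW : (∏ i, halfTurn l ε u i).re = 0) :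
    IsCriticalPoint l (inscribedArm hl hmax hε hε0 u) := by
  rw [isCriticalPoint_iff_diacyclic l hl]
  intro k
  simp only [inscribedArm, direction_arm hl]
  have hu := u.norm_coe
  have hf := circleEq_vertex hl hmax hε hε0 hu k
  have hT := turning_eq hl hmax hε hε0 hu (Fin.last _)
  set V := vertex l (inscribedDirection l ε (u : ℂ))
  set W := ∏ i, halfTurn l ε (u : ℂ) i with hWdef
  have hWn : normSq W = 1 := by
    rw [normSq_eq_norm_sq, norm_prod]
    simp [norm_halfTurn hl hmax hε hu]
  have hW2 : W ^ 2 = -1 := by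
    rw [normSq_apply, hW] at hWn
    apply Complex.ext
    · simp [pow_two, hW]; linarith
    · simp [pow_two, hW]
  have hlast : turning l ε (u : ℂ) (Fin.last _) = - conj (u : ℂ) := by
    rw [turning]
    simp only [Fin.castSucc_lt_last, Finset.filter_true, Finset.prod_pow]
    rw [← hWdef, hW2]; ring
  have hV : halfCurvature l u * V (Fin.last _) = I * conj (u : ℂ) := by
    rw [hlast, tangent] at hT
    linear_combination (I / 2) * hT + halfCurvature l u * V (Fin.last _) * I_mul_I
  have hκ : halfCurvature l u ≠ 0 := by
    intro h0
    rw [h0, ofReal_zero, zero_mul, eq_comm, mul_eq_zero, or_iff_right I_ne_zero] at hV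
    have := congr_arg norm hV
    rw [norm_conj, hu, norm_zero] at this
    exact one_ne_zero this
  apply mul_left_cancel₀ hκ
  rw [circleEq, sub_eq_zero] at hf
  rw [hf, ← re_ofReal_mul, ← mul_assoc, ← conj_ofReal, ← map_mul, hV, map_mul, conj_I, conj_conj,
    mul_assoc, neg_mul, neg_re, I_mul_re, neg_neg]

end
end RobotArm

/-! ### Classification and counting -/

namespace RobotArm
open Complex ComplexConjugate

section
variable {n : ℕ} {l : Fin (n + 2) → ℝ} (hl : ∀ i, 0 < l i) (hmax : ∀ i, i ≠ 0 → l i < l 0)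
  {ε ε' : Fin (n + 2) → ℝ} (hε : ∀ i, ε i * ε i = 1) (hε0 : ε 0 = 1) (hε1 : ε 1 = 1)
  (hε' : ∀ i, ε' i * ε' i = 1) (hε0' : ε' 0 = 1) (hε1' : ε' 1 = 1)

include hε1 hε1' in
lemma inscribedArm_inj {u v : Circle}
    (h : inscribedArm hl hmax hε hε0 u = inscribedArm hl hmax hε' hε0' v) : u = v ∧ ε = ε' := by
  have hz := congr_arg (fun R : moduliSpace l => direction l R.1) h
  simp only [inscribedArm, direction_arm hl] at hz
  have huv : (u : ℂ) = v := by
    obtain ⟨a, ha, ha'⟩ := exists_pos_mul_eq hl hmax hε1 u.norm_coe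
    obtain ⟨b, hb, hb'⟩ := exists_pos_mul_eq hl hmax hε1' v.norm_coe
    exact eq_of_mul_ofReal_eq u.norm_coe v.norm_coe ha hb (by rw [ha', hb', hz])
  refine ⟨Subtype.ext huv, funext fun i => ?_⟩
  cases i using Fin.cases with
  | zero => rw [hε0, hε0']
  | succ i =>
    -- The half turns have positive real part, so each sign is that of the tangential component of
    -- its link.
    have h1 := conj_turning_mul hl hmax hε u.norm_coe i.succ
    have h2 := conj_turning_mul hl hmax hε' v.norm_coe i.succ
    rw [turning_eq hl hmax hε hε0 u.norm_coe] at h1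
    rw [turning_eq hl hmax hε' hε0' v.norm_coe, ← hz, ← huv, h1] at h2
    have h3 := congr_arg Complex.re h2
    rw [re_ofReal_mul, re_ofReal_mul] at h3
    have p1 : 0 < (halfTurn l ε (u : ℂ) i.succ).re := halfTurn_succ_re_pos hl hmax u.norm_coe i
    have p2 : 0 < (halfTurn l ε' (u : ℂ) i.succ).re := halfTurn_succ_re_pos hl hmax u.norm_coe i
    rcases mul_self_eq_one_iff.1 (hε i.succ) with e1 | e1 <;>
    rcases mul_self_eq_one_iff.1 (hε' i.succ) with e2 | e2 <;> rw [e1, e2] at h3 ⊢ <;> linarith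

include hε1 in
lemma isEmbedding_inscribedArm : Topology.IsEmbedding (inscribedArm hl hmax hε hε0) :=
  ((continuous_inscribedArm hl hmax hε hε0).isClosedEmbedding fun _ _ h =>
    (inscribedArm_inj hl hmax hε hε0 hε1 hε hε0 hε1 h).1).isEmbedding

lemma isQuasicyclic_inscribedArm (u : Circle) :
    IsQuasicyclic (inscribedArm hl hmax hε hε0 u).1 :=
  (isQuasicyclic_arm_iff (hl 0) (inscribedDirection_zero hε0 u.norm_coe)).2
    ⟨u, u.norm_coe, circleEq_vertex hl hmax hε hε0 u.norm_coe⟩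

lemma exists_eq_inscribedArm {R : moduliSpace l} (hR : IsQuasicyclic R.1) :
    ∃ (ε : Fin (n + 2) → ℝ) (hε : ∀ i, ε i * ε i = 1) (hε0 : ε 0 = 1) (u : Circle),
      ε 1 = 1 ∧ R = inscribedArm hl hmax hε hε0 u := by
  have hz0 := direction_zero hl R.2
  have hz := norm_direction hl R.2
  have hRz := arm_direction hl R.2
  set z := direction l R.1
  rw [← hRz, isQuasicyclic_arm_iff (hl 0) hz0] at hR
  obtain ⟨u, hu, h⟩ := hR
  have main (u : ℂ) (hu : ‖u‖ = 1) (h : ∀ k, circleEq l u (vertex l z k) = 0) :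
      ∃ (ε : Fin (n + 2) → ℝ) (hε : ∀ i, ε i * ε i = 1) (hε0 : ε 0 = 1) (u' : Circle),
        u' = u ∧ ε = orientation l z u ∧ R = inscribedArm hl hmax hε hε0 u' := by
    refine ⟨orientation l z u, orientation_mul_self, rfl, ⟨u, mem_sphere_zero_iff_norm.2 hu⟩, rfl,
      rfl, Subtype.ext ?_⟩
    change R.1 = arm l (inscribedDirection l (orientation l z u) u)
    rw [inscribedDirection_orientation hl hmax hz hz0 hu h, hRz]
  have h1 (u : ℂ) : orientation l z u 1 =
      if 0 < (conj (tangent l u (vertex l z 1)) * z 1).re then 1 else -1 := rfl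
  obtain ⟨ε, hε, hε0, u', hu', hεu, hR⟩ := main u hu h
  by_cases hpos : 0 < (conj (tangent l u (vertex l z 1)) * z 1).re
  · exact ⟨ε, hε, hε0, u', by rw [hεu, h1, if_pos hpos], hR⟩
  -- Reversing the orientation of the curve makes the second link run forwards.
  · obtain ⟨ε', hε', hε0', v, hv, hεv, hR'⟩ := main (-u) (by rwa [norm_neg])
      fun k => by rw [circleEq_neg, h, neg_zero]
    refine ⟨ε', hε', hε0', v, ?_, hR'⟩
    rw [hεv, h1, if_pos]
    rw [tangent_neg, map_neg, neg_mul, neg_re, neg_pos]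
    -- The second link is never normal to the circle, since it is shorter than the diameter.
    refine lt_of_le_of_ne (not_lt.1 hpos) fun h0 => ?_
    have e := congr_arg (fun R : moduliSpace l => direction l R.1) hR
    simp only [inscribedArm, direction_arm hl] at e
    replace e : z = inscribedDirection l ε u := by rw [← hu']; exact e
    have h3 := conj_turning_mul hl hmax hε hu (Fin.succ 0)
    rw [turning_eq hl hmax hε hε0 hu, ← e] at h3
    have h4 := congr_arg Complex.re h3
    rw [re_ofReal_mul] at h4
    change (conj (tangent l u (vertex l z 1)) * z 1).re = _ at h4
    rw [h0, eq_comm, mul_eq_zero] at h4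
    rcases h4 with h4 | h4
    · have := hε (Fin.succ 0); rw [h4] at this; norm_num at this
    · exact (halfTurn_succ_re_pos hl hmax hu 0).ne' h4

lemma halfTurn_of_im_eq_zero {u : ℂ} (hu : u.im = 0) (i : Fin (n + 1)) :
    halfTurn l ε u i.succ = 1 := by
  simp [halfTurn_succ, halfCurvature, hu]

include hε1 in
-- If the arm is aligned its second link is real, hence so is u by `exists_pos_mul_eq`. Conversely,
-- for real u the equation of the circle reduces to that of the real axis.
lemma isAligned_inscribedArm_iff (u : Circle) :
    IsAligned (inscribedArm hl hmax hε hε0 u).1 ↔ (u : ℂ).im = 0 := by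
  change IsAligned (arm l (inscribedDirection l ε u)) ↔ _
  rw [isAligned_arm_iff (hl 0).ne' (inscribedDirection_zero hε0 u.norm_coe)]
  constructor
  · intro h
    obtain ⟨a, ha, ha'⟩ := exists_pos_mul_eq hl hmax hε1 u.norm_coe
    have h2 := vertex_succ l (inscribedDirection l ε u) 1
    have h3 := congr_arg Complex.im h2
    rw [add_im, h, h, zero_add, im_ofReal_mul, eq_comm, mul_eq_zero, or_iff_right (hl 1).ne'] at h3
    have h4 := congr_arg Complex.im ha'
    rw [im_ofReal_mul, add_im, h3, ofReal_im, add_zero, mul_eq_zero, or_iff_right ha.ne'] at h4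
    exact h4
  · intro hu k
    have hs (i) : (halfTurn l ε (u : ℂ) i).im = 0 := by
      cases i using Fin.cases with
      | zero => exact hu
      | succ i => rw [halfTurn_of_im_eq_zero hu, one_im]
    have hf := circleEq_vertex hl hmax hε hε0 u.norm_coe k
    have hne : (u : ℂ).re ≠ 0 := by
      intro h0
      have := u.norm_coe
      rw [show (u : ℂ) = 0 from Complex.ext h0 hu, norm_zero] at this
      exact zero_ne_one this
    simpa [circleEq, halfCurvature, hu, hne] using hf

lemma circle_im_eq_zero_iff (u : Circle) : (u : ℂ).im = 0 ↔ u = 1 ∨ u = Circle.exp Real.pi := by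
  constructor
  · intro h
    have h1 : (u : ℂ).re * (u : ℂ).re = 1 := by
      have := Circle.normSq_coe u
      rwa [normSq_apply, h, mul_zero, add_zero] at this
    rcases mul_self_eq_one_iff.1 h1 with h1 | h1
    · left; apply Circle.ext; apply Complex.ext <;> simp [h, h1]
    · right; apply Circle.ext; apply Complex.ext <;> simp [h, h1]
  · rintro (rfl | rfl) <;> simp

lemma circle_one_ne_exp_pi : (1 : Circle) ≠ Circle.exp Real.pi := by
  intro h
  have := congr_arg (fun u : Circle => (u : ℂ).re) h
  simp at this
  norm_num at this

include hε1 in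
lemma encard_aligned : (Set.range (inscribedArm hl hmax hε hε0) ∩
    {R | IsAligned R.1}).encard = 2 := by
  have hinj := (isEmbedding_inscribedArm hl hmax hε hε0 hε1).injective
  have : Set.range (inscribedArm hl hmax hε hε0) ∩ {R | IsAligned R.1} =
      inscribedArm hl hmax hε hε0 '' {1, Circle.exp Real.pi} := by
    ext R
    constructor
    · rintro ⟨⟨u, rfl⟩, h⟩
      exact ⟨u, (circle_im_eq_zero_iff u).1 ((isAligned_inscribedArm_iff hl hmax hε hε0 hε1 u).1 h),
        rfl⟩
    · rintro ⟨u, h, rfl⟩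
      exact ⟨⟨u, rfl⟩, (isAligned_inscribedArm_iff hl hmax hε hε0 hε1 u).2
        ((circle_im_eq_zero_iff u).2 h)⟩
  rw [this, hinj.encard_image, Set.encard_pair circle_one_ne_exp_pi]

include hε1 in
lemma two_le_encard_critical : 2 ≤ (Set.range (inscribedArm hl hmax hε hε0) ∩
    {R | IsCriticalPoint l R}).encard := by
  have hinj := (isEmbedding_inscribedArm hl hmax hε hε0 hε1).injective
  set g : ℝ → ℝ := fun φ => (∏ i, halfTurn l ε (Circle.exp φ : ℂ) i).re with hg
  have hcont : Continuous g := Complex.continuous_re.comp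
    (continuous_finsetProd _ fun i _ => (continuous_halfTurn i).comp Circle.exp.continuous)
  -- At real u all half turns after the first are trivial, so W = u.
  have hreal (φ : ℝ) (hφ : Real.sin φ = 0) : g φ = Real.cos φ := by
    have him : (Circle.exp φ : ℂ).im = 0 := by
      rw [Circle.coe_exp, exp_ofReal_mul_I_im, hφ]
    rw [hg]
    simp only [Fin.prod_univ_succ (fun i => halfTurn l ε (Circle.exp φ : ℂ) i),
      halfTurn_of_im_eq_zero him, halfTurn_zero, Finset.prod_const_one, mul_one]
    rw [Circle.coe_exp, exp_ofReal_mul_I_re]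
  have g0 : g 0 = 1 := by rw [hreal _ (by simp)]; simp
  have g1 : g Real.pi = -1 := by rw [hreal _ (by simp)]; simp
  have g2 : g (2 * Real.pi) = 1 := by rw [hreal _ (by simp)]; simp
  have hπ := Real.pi_pos
  obtain ⟨φ, hφ, hgφ⟩ := intermediate_value_Ioo' hπ.le hcont.continuousOn
    (show (0 : ℝ) ∈ Set.Ioo (g Real.pi) (g 0) by rw [g0, g1]; norm_num)
  obtain ⟨ψ, hψ, hgψ⟩ := intermediate_value_Ioo (show Real.pi ≤ 2 * Real.pi by linarith)
    hcont.continuousOn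
    (show (0 : ℝ) ∈ Set.Ioo (g Real.pi) (g (2 * Real.pi)) by rw [g2, g1]; norm_num)
  -- The two zeros lie on opposite open half circles, told apart by the sign of the sine.
  have hne : Circle.exp φ ≠ Circle.exp ψ := by
    intro h
    have h1 := congr_arg (fun u : Circle => (u : ℂ).im) h
    simp only [Circle.coe_exp, exp_ofReal_mul_I_im] at h1
    have h2 := Real.sin_pos_of_pos_of_lt_pi hφ.1 hφ.2
    have h3 : 0 < Real.sin (ψ - Real.pi) :=
      Real.sin_pos_of_pos_of_lt_pi (by linarith [hψ.1]) (by linarith [hψ.2])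
    rw [Real.sin_sub_pi] at h3
    linarith
  rw [← Set.encard_pair hne, ← hinj.encard_image]
  refine Set.encard_le_encard ?_
  rintro _ ⟨u, hu, rfl⟩
  refine ⟨⟨u, rfl⟩, ?_⟩
  rcases hu with rfl | rfl
  · exact isCriticalPoint_of_re_prod_eq_zero hl hmax hε hε0 _ hgφ
  · exact isCriticalPoint_of_re_prod_eq_zero hl hmax hε hε0 _ hgψ

/-- The orientations of the links with the first two of them positive. -/
def signVector (b : Fin n → Bool) : Fin (n + 2) → ℝ :=
  Fin.cons 1 (Fin.cons 1 fun i => if b i then 1 else -1)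

lemma signVector_mul_self (b : Fin n → Bool) (i : Fin (n + 2)) :
    signVector b i * signVector b i = 1 := by
  cases i using Fin.cases with
  | zero => simp [signVector]
  | succ i =>
    cases i using Fin.cases with
    | zero => simp [signVector]
    | succ i => simp only [signVector, Fin.cons_succ]; split_ifs <;> norm_num

lemma signVector_injective : Function.Injective (signVector (n := n)) := by
  intro b c h
  ext1 i
  have := congr_fun h i.succ.succ
  simp only [signVector, Fin.cons_succ] at this
  cases hb : b i <;> cases hc : c i <;> simp [hb, hc] at this ⊢ <;> norm_num at this

include hε hε0 hε1 in
lemma exists_eq_signVector : ∃ b, ε = signVector b := by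
  refine ⟨fun i => decide (ε i.succ.succ = 1), funext fun i => ?_⟩
  cases i using Fin.cases with
  | zero => simp [signVector, hε0]
  | succ i =>
    cases i using Fin.cases with
    | zero => simpa [signVector] using hε1
    | succ i =>
      rcases mul_self_eq_one_iff.1 (hε i.succ.succ) with h | h <;>
      simp [signVector, h]

end

lemma ENat.sum_eq_iff {ι : Type*} [Fintype ι] (f : ι → ℕ∞) (k : ℕ) (hf : ∀ i, k ≤ f i) :
    ∑ i, f i = Fintype.card ι * k ↔ ∀ i, f i = k := by
  classical
  refine ⟨fun h i => ?_, fun h => by simp [h]⟩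
  -- A finite total excludes infinite terms, which reduces the claim to natural numbers.
  have htop : ∀ i, f i ≠ ⊤ := by
    intro i hi
    have : f i ≤ ∑ i, f i := Finset.single_le_sum (fun _ _ => zero_le) (Finset.mem_univ i)
    rw [hi, h, top_le_iff] at this
    exact ENat.natCast_ne_top (Fintype.card ι * k) (by exact_mod_cast this)
  choose g hg using fun i => ENat.ne_top_iff_exists.1 (htop i)
  simp only [← hg] at h hf ⊢
  norm_cast at h hf ⊢
  have hcard : ∑ _i : ι, k = ∑ i, g i := by simp [h]
  exact ((Finset.sum_eq_sum_iff_of_le fun i _ => by exact_mod_cast hf i).1 hcard i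
    (Finset.mem_univ i)).symm

end RobotArm

theorem theorem2 (m : ℕ) (l : Fin (m + 2) → ℝ) (hpos : ∀ i, 0 < l i)
    (hmax : ∀ i, i ≠ 0 → l i < l 0) :
    ∃ C : Fin (2 ^ m) → Set (RobotArm.moduliSpace l),
      (∀ j, RobotArm.IsEmbeddedCircle (C j)) ∧
      Pairwise (fun i j => Disjoint (C i) (C j)) ∧
      (⋃ j, C j) = {R : RobotArm.moduliSpace l | RobotArm.IsQuasicyclic R.1} ∧
      (∀ j, 2 ≤ (C j ∩ {R | RobotArm.IsCriticalPoint l R}).encard) ∧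
      ((∀ R, RobotArm.IsCriticalPoint l R → RobotArm.IsNondegenerateCriticalPoint l R) →
        (RobotArm.AreaIsPerfectMorse l ↔
          ∀ j, (C j ∩ {R | RobotArm.IsCriticalPoint l R}).encard = 2)) ∧
      (∀ j, (C j ∩ {R | RobotArm.IsAligned R.1}).encard = 2) := by
  open RobotArm in
  have e : Fin (2 ^ m) ≃ (Fin m → Bool) := (Fintype.equivFinOfCardEq (by simp)).symm
  let γ (b : Fin m → Bool) : Circle → moduliSpace l :=
    inscribedArm hpos hmax (signVector_mul_self b) rfl
  have hdisj : Pairwise fun i j => Disjoint (Set.range (γ (e i))) (Set.range (γ (e j))) := by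
    intro i j hij
    rw [Set.disjoint_left]
    rintro _ ⟨u, rfl⟩ ⟨v, hv⟩
    have := (inscribedArm_inj hpos hmax _ _ rfl _ _ rfl hv).2
    exact hij (e.injective (signVector_injective this)).symm
  have hunion : (⋃ j, Set.range (γ (e j))) = {R : moduliSpace l | IsQuasicyclic R.1} := by
    ext R
    simp only [Set.mem_iUnion, Set.mem_ofPred_eq]
    constructor
    · rintro ⟨j, u, rfl⟩
      exact isQuasicyclic_inscribedArm hpos hmax _ _ u
    · intro hR
      obtain ⟨ε, hε, hε0, u, hε1, rfl⟩ := exists_eq_inscribedArm hpos hmax hR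
      obtain ⟨b, rfl⟩ := exists_eq_signVector hε hε0 hε1
      exact ⟨e.symm b, u, by rw [e.apply_symm_apply]⟩
  have htwo (j) : 2 ≤ (Set.range (γ (e j)) ∩ {R | IsCriticalPoint l R}).encard :=
    two_le_encard_critical hpos hmax _ _ rfl
  refine ⟨fun j => Set.range (γ (e j)),
    fun j => ⟨γ (e j), isEmbedding_inscribedArm hpos hmax _ _ rfl, rfl⟩, hdisj, hunion, htwo,
    fun hnd => ?_, fun j => encard_aligned hpos hmax _ _ rfl⟩
  -- Critical points are quasicyclic, so the circles contain all of them.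
  have hcrit : {R : moduliSpace l | IsCriticalPoint l R} =
      ⋃ j, Set.range (γ (e j)) ∩ {R | IsCriticalPoint l R} := by
    rw [← Set.iUnion_inter, hunion]
    ext R
    exact ⟨fun h => ⟨h.isQuasicyclic hpos, h⟩, fun h => h.2⟩
  have hsum : {R : moduliSpace l | IsCriticalPoint l R}.encard =
      ∑ j, (Set.range (γ (e j)) ∩ {R | IsCriticalPoint l R}).encard := by
    conv_lhs => rw [hcrit]
    rw [Set.encard_iUnion_of_finite fun i j hij => (hdisj hij).mono Set.inter_subset_left
      Set.inter_subset_left, finsum_eq_sum_of_fintype]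
  have hbetti : ∑' k, bettiNumber (moduliSpace l) k = 2 ^ (m + 1) := by
    rw [← tsum_bettiNumber_torus (m + 1)]
    exact tsum_congr fun k => bettiNumber_congr (torusHomeomorph hpos) k
  have hiff := ENat.sum_eq_iff
    (fun j => (Set.range (γ (e j)) ∩ {R | IsCriticalPoint l R}).encard) 2 htwo
  rw [← hsum, Fintype.card_fin] at hiff
  -- Nondegeneracy being assumed, perfection is only the count: a total of 2^m · 2 over 2^m circles.
  rw [AreaIsPerfectMorse, and_iff_right hnd, hbetti, pow_succ]
  exact_mod_cast hiff
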